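/- Let $\mathbb K$ be a field, $R=\mathbb K[x_1,\dots,x_n]$, and let $I\subseteq R$ be a squarefree monomial ideal whose minimal set $G(I)$ of monomial generators has at most $5$ elements. Then $I$ admits a minimal pruned resolution, that is: there is an order $m_1,\dots,m_q$ of the elements of $G(I)$ for which the pruned complex defined below is a minimal $\mathbb Z^n$-graded free resolution of $R/I$ (it is a resolution, and the matrices of its differentials contain no invertible element). Here, for $\sigma\subseteq\{1,\dots,q\}$, let $m_\sigma=\operatorname{lcm}(m_i\mid i\in\sigma)=\mathbf x^{gr(\sigma)}$ (so $m_\emptyset=1$). The Taylor graph has as vertices (cells) all subsets $\sigma$, including $\emptyset$, and as edges the pairs $\sigma\to\sigma\setminus\{i\}$ with $i\in\sigma$, with incidence number $[\sigma:\sigma\setminus\{i\}]=(-1)^{\#\{k\in\sigma\,\mid\,k<i\}}$. Pruning algorithm: for $j=1,\dots,q$, for every $\sigma\not\ni j$ such that $\sigma$ and $\sigma\cup\{j\}$ have both survived the previous steps and $m_\sigma=m_{\sigma\cup\{j\}}$, prune the edge between $\sigma$ and $\sigma\cup\{j\}$ and remove its two vertices. Let $\mathscr A$ be the set of pruned edges;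 a cell is critical if it lies on no pruned edge. Let $G^{\mathscr A}$ be the Taylor graph with the edges in $\mathscr A$ reversed; an edge $\sigma\to\sigma'$ not in $\mathscr A$ has weight $[\sigma:\sigma']$, the reversal $\sigma'\Rightarrow\sigma$ of an edge $\sigma\to\sigma'$ in $\mathscr A$ has weight $-1/[\sigma:\sigma']$, and the weight $m(\mathcal P)$ of a directed path $\mathcal P$ is the product of the weights of its edges (a path of length $0$ has weight $1$). The pruned complex has as its $i$-th module $F_i$ the free $R$-module on the elements $e_\sigma$, $\sigma$ critical with $|\sigma|=i$, where $e_\sigma$ has degree $gr(\sigma)$; its differentials are $$e_\sigma\;\mapsto\;\sum_{\sigma'\subset\sigma,\ |\sigma'|=|\sigma|-1}[\sigma:\sigma']\ \sum_{\substack{\sigma''\text{ critical}\\ |\sigma''|=|\sigma|-1}}\ \sum_{\mathcal P:\sigma'\to\sigma''\text{ path in }G^{\mathscr A}} m(\mathcal P)\,\mathbf x^{gr(\sigma)-gr(\sigma'')}\,e_{\sigma''},$$ and its augmentation $F_0\to R/I$ sends $e_\emptyset$ to $1$ (if $\emptyset$ is critical). -/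

import Mathlib

open MvPolynomial

namespace Pruned

/-! ### Squarefree monomial ideals and their minimal monomial generators -/

section Ideals

variable {K : Type*} [Field K] {n : ℕ}

/-- `I` is generated by squarefree monomials. A monomial `x ^ a` is represented by its
exponent vector `a`. -/
def IsSquarefreeMonomialIdeal (I : Ideal (MvPolynomial (Fin n) K)) : Prop :=
  ∃ S : Set (Fin n →₀ ℕ), (∀ a ∈ S, ∀ i, a i ≤ 1) ∧
    I = Ideal.span ((fun a => monomial a (1 : K)) '' S)

/-- The exponent vectors of the monomials in `I` that are minimal for divisibility. For a monomial
ideal `I` this is its unique minimal set `G(I)` of monomial generators. -/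
def minimalGenerators (I : Ideal (MvPolynomial (Fin n) K)) : Set (Fin n →₀ ℕ) :=
  {a | Minimal (fun b => monomial b (1 : K) ∈ I) a}

end Ideals

/-! ### The Taylor complex and the pruning algorithm

Throughout, `m : Fin q → (Fin n →₀ ℕ)` is the ordered list of (the exponents of) the generators.
The cells of the Taylor complex are all subsets of `Fin q`; the cell `σ` has dimension
`σ.card - 1`, and the empty cell is the one that indexes the basis element of `F₀`. -/

section Pruning

variable {q n : ℕ}

/-- The multidegree of a cell: the exponent of `lcm (m i | i ∈ σ)`. -/
noncomputable def gr (m : Fin q → (Fin n →₀ ℕ)) (σ : Finset (Fin q)) : Fin n →₀ ℕ := σ.sup m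

/-- There is an edge `σ ⟶ τ` of the Taylor graph: `τ` is a facet of `σ`. -/
def IsEdge (σ τ : Finset (Fin q)) : Prop := τ ⊆ σ ∧ σ.card = τ.card + 1

/-- If `alive` is the set of cells that survived the steps before step `j`, then the edge between
`σ` and `σ ∪ {j}` (where `j ∉ σ`) is pruned in step `j`. An edge survives as long as both its
vertices do. -/
def PrunedIn (m : Fin q → (Fin n →₀ ℕ)) (alive : Set (Finset (Fin q))) (j : Fin q)
    (σ : Finset (Fin q)) : Prop :=
  j ∉ σ ∧ σ ∈ alive ∧ insert j σ ∈ alive ∧ gr m σ = gr m (insert j σ)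

/-- The cells that survive the first `k` steps of the pruning algorithm (the steps are numbered
by `0, 1, …, q - 1`): pruning an edge removes its two vertices. -/
def survivors (m : Fin q → (Fin n →₀ ℕ)) : ℕ → Set (Finset (Fin q))
  | 0 => Set.univ
  | k + 1 => {ρ | ρ ∈ survivors m k ∧ ∀ j : Fin q, (j : ℕ) = k →
      ∀ σ, PrunedIn m (survivors m k) j σ → ρ ≠ σ ∧ ρ ≠ insert j σ}

/-- The set of pruned edges: the edge with endpoints `σ` and `τ = σ ∪ {j}`, `j ∉ σ`, is
pruned by the algorithm (in step `j`). -/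
def IsPruned (m : Fin q → (Fin n →₀ ℕ)) (σ τ : Finset (Fin q)) : Prop :=
  ∃ j : Fin q, τ = insert j σ ∧ PrunedIn m (survivors m j) j σ

/-- A cell is critical if it is an endpoint of no pruned edge. -/
def IsCritical (m : Fin q → (Fin n →₀ ℕ)) (σ : Finset (Fin q)) : Prop :=
  ∀ τ, ¬ IsPruned m σ τ ∧ ¬ IsPruned m τ σ

/-- The edges `σ ⟶ τ` of the Taylor graph after reversing all pruned edges. -/
def MorseEdge (m : Fin q → (Fin n →₀ ℕ)) (σ τ : Finset (Fin q)) : Prop :=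
  (IsEdge σ τ ∧ ¬ IsPruned m τ σ) ∨ IsPruned m σ τ

/-- The critical cells of cardinality `i` (dimension `i - 1`). They index the basis of the `i`-th
module of the pruned resolution. -/
abbrev CriticalCell (m : Fin q → (Fin n →₀ ℕ)) (i : ℕ) : Type :=
  {σ : Finset (Fin q) // IsCritical m σ ∧ σ.card = i}

noncomputable instance (m : Fin q → (Fin n →₀ ℕ)) (i : ℕ) : Fintype (CriticalCell m i) :=
  Fintype.ofFinite _

end Pruning

/-! ### The pruned (Morse) complex -/

section Complex

variable (K : Type*) [Field K] {q n : ℕ}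

/-- The incidence number `[σ : τ]` of the simplex: the sign `(-1) ^ #{k ∈ σ | k < i}` if
`τ = σ \ {i}` with `i ∈ σ`, and `0` if `τ` is not a facet of `σ`. -/
def incidence (σ τ : Finset (Fin q)) : K :=
  ∑ i ∈ σ, if τ = σ.erase i then (-1) ^ (σ.filter (· < i)).card else 0

open Classical in
/-- The weight of an edge of the Taylor graph with pruned edges reversed:
`-1 / [τ : σ]` for a reversed edge from `σ` up to `τ`, and `[σ : τ]` for any other edge. -/
noncomputable def edgeWeight (m : Fin q → (Fin n →₀ ℕ)) (σ τ : Finset (Fin q)) : K :=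
  if IsPruned m σ τ then -(1 / incidence K τ σ) else incidence K σ τ

open Classical in
/-- The sum over all directed paths `P` from `σ` to `τ`, in the graph with the pruned edges
reversed, of the product of the weights of the edges of `P`. The paths are sorted by their number
`l` of edges. The set of pruned edges is an acyclic matching, so a path visits each of the `2 ^ q`
cells at most once and has less than `2 ^ q` edges. -/
noncomputable def pathSum (m : Fin q → (Fin n →₀ ℕ)) (σ τ : Finset (Fin q)) : K :=
  ∑ l ∈ Finset.range (2 ^ q),
    ∑ P : Fin (l + 1) → Finset (Fin q) with
        P 0 = σ ∧ P (Fin.last l) = τ ∧ ∀ k : Fin l, MorseEdge m (P k.castSucc) (P k.succ),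
      ∏ k : Fin l, edgeWeight K m (P k.castSucc) (P k.succ)

open Classical in
/-- The scalar coefficient of `e_τ` in the differential of `e_σ`: the sum of
`[σ : ρ] * (path sum from ρ to τ)` over all facets `ρ` of `σ`. -/
noncomputable def morseCoeff (m : Fin q → (Fin n →₀ ℕ)) (σ τ : Finset (Fin q)) : K :=
  ∑ ρ : Finset (Fin q) with IsEdge σ ρ, incidence K σ ρ * pathSum K m ρ τ

/-- The matrix of the differential from homological degree `i + 1` to homological degree `i`:
`e_σ ↦ ∑ τ, morseCoeff σ τ * x ^ (gr σ - gr τ) * e_τ`. (Multidegrees do not increase along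
the paths, so that `gr τ ≤ gr σ` whenever the coefficient is not zero.) -/
noncomputable def diffMatrix (m : Fin q → (Fin n →₀ ℕ)) (i : ℕ) :
    Matrix (CriticalCell m i) (CriticalCell m (i + 1)) (MvPolynomial (Fin n) K) :=
  fun τ σ => monomial (gr m σ.1 - gr m τ.1) (morseCoeff K m σ.1 τ.1)

/-- The differential `F_(i+1) → F_i`, where `F_i` is the free module on the critical cells of
cardinality `i`. -/
noncomputable def diff (m : Fin q → (Fin n →₀ ℕ)) (i : ℕ) :
    (CriticalCell m (i + 1) → MvPolynomial (Fin n) K) →ₗ[MvPolynomial (Fin n) K]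
      (CriticalCell m i → MvPolynomial (Fin n) K) :=
  (diffMatrix K m i).mulVecLin

variable {K}

/-- The augmentation `F_0 → R / I`, sending each basis element of `F_0` to `1`. (`F_0` has the
basis `e_∅` if the empty cell is critical, that is if `I ≠ R`, and it is zero if `I = R`.) -/
noncomputable def augmentation (I : Ideal (MvPolynomial (Fin n) K)) (m : Fin q → (Fin n →₀ ℕ)) :
    (CriticalCell m 0 → MvPolynomial (Fin n) K) →ₗ[MvPolynomial (Fin n) K]
      (MvPolynomial (Fin n) K ⧸ I) :=
  (Submodule.mkQ I).comp (∑ σ : CriticalCell m 0, LinearMap.proj σ)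

/-- The pruned complex is a multigraded free resolution of `R / I`:
`⋯ → F_2 → F_1 → F_0 → R / I → 0` is exact, and its differentials are homogeneous of degree `0`
when the basis element of `σ` has degree `gr σ`. -/
structure IsResolution (I : Ideal (MvPolynomial (Fin n) K)) (m : Fin q → (Fin n →₀ ℕ)) :
    Prop where
  surjective : Function.Surjective (augmentation I m)
  exact_zero : Function.Exact (diff K m 0) (augmentation I m)
  exact_succ : ∀ i, Function.Exact (diff K m (i + 1)) (diff K m i)
  homogeneous : ∀ i (τ : CriticalCell m i) (σ : CriticalCell m (i + 1)),
    diffMatrix K m i τ σ ≠ 0 → gr m τ.1 ≤ gr m σ.1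

variable (K) in
/-- No entry of a matrix of a differential is invertible. -/
def IsMinimal (m : Fin q → (Fin n →₀ ℕ)) : Prop :=
  ∀ i (τ : CriticalCell m i) (σ : CriticalCell m (i + 1)), ¬ IsUnit (diffMatrix K m i τ σ)

/-- For some order `m 0, …, m (q - 1)` of the minimal generators of `I`, the pruned complex is a
minimal free resolution of `R / I`. -/
def AdmitsMinimalPrunedResolution (I : Ideal (MvPolynomial (Fin n) K)) : Prop :=
  ∃ (q : ℕ) (m : Fin q → (Fin n →₀ ℕ)), Function.Injective m ∧
    Set.range m = minimalGenerators I ∧ IsResolution I m ∧ IsMinimal K m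

end Complex

end Pruned

/-! Two statements combine: for every order of the generators the pruned complex is a resolution,
and for at most five generators some order makes it minimal.

Resolution. The pruned edges form a matching of faces of the simplex. It is acyclic: among cells of
equal degree that are alive at step `k`, a gradient path never loses the vertex `k` once it has it
(`exists_rank_survivors`). So the weights of gradient paths sum to a finite Neumann series
(`gradientFlow`), and Gaussian elimination along the matching (`exists_morse_projection`) gives a
projection `p`, homotopic to the identity, whose image is equivalent to the span of the critical
cells. A path between cells of equal size that ends in a critical cell must alternate between up and
down, so the path sums of the definition are entries of that series (`pathSum_eq_gradientFlow`).
Multidegrees never increase along any of these maps. Hence exactness in multidegree `b` follows from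
the cone contraction of the simplex on the generators dividing `b` (`exists_vecMul_morseMatrix_eq`).

Minimality. A unit entry requires a gradient path between critical cells inside one fiber of `gr`.
The fiber over `b` is an upper set in the power set of the divisors of `b`, and pruning inside it
depends only on this upper set and on the induced order of the divisors. This leaves a finite check,
done on bit masks (`morseMatrix_eq_zero_of_isGood`). With at most three divisors every order is
good. With four divisors every order is good unless all four triples lie in the fiber, and in any
case two out of three fixed orders are good. With five divisors one of three fixed orders is good.

For five generators the only possible conflict is between the full fiber and a four-element fiber
containing all its triples (`IsHollow`). There is at most one such fiber. If it exists, every cell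
of the full fiber contains the omitted generator. Then each of the two fibers accepts at least two
of the same three orders, so a common order exists. -/

namespace Pruned

/-! ### The pruned edges form an acyclic matching. -/

section Matching

variable {q n : ℕ} {m : Fin q → (Fin n →₀ ℕ)}

theorem survivors_antitone (m : Fin q → (Fin n →₀ ℕ)) : Antitone (survivors m) :=
  antitone_nat_of_succ_le fun _ _ h => h.1

theorem PrunedIn.not_mem_survivors {j : Fin q} {σ : Finset (Fin q)}
    (h : PrunedIn m (survivors m j) j σ) :
    σ ∉ survivors m (j + 1) ∧ insert j σ ∉ survivors m (j + 1) :=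
  ⟨fun h' => (h'.2 j rfl σ h).1 rfl, fun h' => (h'.2 j rfl σ h).2 rfl⟩

/-- Both ends of an edge pruned in step `i` are dead from step `i + 1` on, so one cell cannot meet
pruned edges of two steps. All matching properties below reduce to this. -/
theorem PrunedIn.stage_eq {i j : Fin q} {σ τ ρ : Finset (Fin q)}
    (hσ : PrunedIn m (survivors m i) i σ) (hτ : PrunedIn m (survivors m j) j τ)
    (h₁ : ρ = σ ∨ ρ = insert i σ) (h₂ : ρ = τ ∨ ρ = insert j τ) : i = j := by
  have key : ∀ {i j : Fin q} {σ τ : Finset (Fin q)}, PrunedIn m (survivors m i) i σ →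
      PrunedIn m (survivors m j) j τ → (ρ = σ ∨ ρ = insert i σ) → (ρ = τ ∨ ρ = insert j τ) →
      ¬ i < j := by
    intro i j σ τ hσ hτ h₁ h₂ hij
    have h3 : ρ ∈ survivors m j := by
      rcases h₂ with rfl | rfl
      exacts [hτ.2.1, hτ.2.2.1]
    have h4 : ρ ∈ survivors m (i + 1) := survivors_antitone m (Nat.succ_le_of_lt hij) h3
    rcases h₁ with rfl | rfl
    exacts [hσ.not_mem_survivors.1 h4, hσ.not_mem_survivors.2 h4]
  exact le_antisymm (not_lt.1 (key hτ hσ h₂ h₁)) (not_lt.1 (key hσ hτ h₁ h₂))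

theorem IsPruned.gr_eq {σ τ : Finset (Fin q)} (h : IsPruned m σ τ) : gr m σ = gr m τ := by
  obtain ⟨j, rfl, h⟩ := h
  exact h.2.2.2

theorem IsPruned.isEdge {σ τ : Finset (Fin q)} (h : IsPruned m σ τ) : IsEdge τ σ := by
  obtain ⟨j, rfl, h⟩ := h
  exact ⟨Finset.subset_insert _ _, Finset.card_insert_of_notMem h.1⟩

theorem IsPruned.right_unique {σ τ τ' : Finset (Fin q)} (h : IsPruned m σ τ)
    (h' : IsPruned m σ τ') : τ = τ' := by
  obtain ⟨i, rfl, h⟩ := h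
  obtain ⟨j, rfl, h'⟩ := h'
  rw [h.stage_eq h' (Or.inl rfl) (Or.inl rfl)]

theorem IsPruned.left_unique {σ σ' τ : Finset (Fin q)} (h : IsPruned m σ τ)
    (h' : IsPruned m σ' τ) : σ = σ' := by
  obtain ⟨i, rfl, h⟩ := h
  obtain ⟨j, hj, h'⟩ := h'
  obtain rfl := h.stage_eq h' (ρ := insert i σ) (Or.inr rfl) (Or.inr hj)
  rw [← Finset.erase_insert h.1, hj, Finset.erase_insert h'.1]

theorem IsPruned.not_isPruned_left {σ τ ρ : Finset (Fin q)} (h : IsPruned m σ τ) :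
    ¬ IsPruned m τ ρ := by
  rintro ⟨j, rfl, h'⟩
  obtain ⟨i, rfl, h⟩ := h
  obtain rfl := h.stage_eq h' (ρ := insert i σ) (Or.inr rfl) (Or.inl rfl)
  exact h'.1 (Finset.mem_insert_self _ _)

theorem IsEdge.gr_le (m : Fin q → (Fin n →₀ ℕ)) {σ τ : Finset (Fin q)} (h : IsEdge σ τ) :
    gr m τ ≤ gr m σ :=
  Finset.sup_mono h.1

theorem isEdge_iff {σ τ : Finset (Fin q)} : IsEdge σ τ ↔ ∃ i ∈ σ, τ = σ.erase i := by
  constructor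
  · rintro ⟨h, hc⟩
    obtain ⟨i, hi⟩ := Finset.card_eq_one.1
      (show (σ \ τ).card = 1 by rw [Finset.card_sdiff_of_subset h]; omega)
    refine ⟨i, (Finset.mem_sdiff.1 (hi ▸ Finset.mem_singleton_self i)).1, ?_⟩
    rw [← Finset.sdiff_singleton_eq_erase, ← hi, Finset.sdiff_sdiff_eq_self h]
  · rintro ⟨i, hi, rfl⟩
    exact ⟨Finset.erase_subset _ _, (Finset.card_erase_add_one hi).symm⟩

/-- A cell is the lower end of a pruned edge. -/
def IsLower (m : Fin q → (Fin n →₀ ℕ)) (σ : Finset (Fin q)) : Prop := ∃ τ, IsPruned m σ τ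

/-- A cell is the upper end of a pruned edge. -/
def IsUpper (m : Fin q → (Fin n →₀ ℕ)) (σ : Finset (Fin q)) : Prop := ∃ τ, IsPruned m τ σ

theorem isCritical_iff {σ : Finset (Fin q)} : IsCritical m σ ↔ ¬ IsLower m σ ∧ ¬ IsUpper m σ := by
  simp only [IsCritical, IsLower, IsUpper, not_exists, forall_and]

theorem IsLower.not_isUpper {σ : Finset (Fin q)} (h : IsLower m σ) : ¬ IsUpper m σ := by
  rintro ⟨τ, h'⟩
  obtain ⟨ρ, h⟩ := h
  exact h'.not_isPruned_left h

/-- A step of a gradient path between lower cells: up along a pruned edge and down along another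
edge. -/
def GradientStep (m : Fin q → (Fin n →₀ ℕ)) (ρ ρ' : Finset (Fin q)) : Prop :=
  ∃ μ, IsPruned m ρ μ ∧ IsEdge μ ρ' ∧ ¬ IsPruned m ρ' μ

theorem GradientStep.gr_le {ρ ρ' : Finset (Fin q)} (h : GradientStep m ρ ρ') :
    gr m ρ' ≤ gr m ρ := by
  obtain ⟨μ, h1, h2, -⟩ := h
  exact (h2.gr_le m).trans_eq h1.gr_eq.symm

/-- Acyclicity inside a fiber of `gr`, by downward induction on `k`: the rank for the survivors of
step `k` is refined by how a cell behaves in that step. -/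
theorem exists_rank_survivors (m : Fin q → (Fin n →₀ ℕ)) (k : ℕ) :
    ∃ f : Finset (Fin q) → ℕ, ∀ ρ ρ', ρ ∈ survivors m k → ρ' ∈ survivors m k →
      GradientStep m ρ ρ' → IsLower m ρ' → gr m ρ = gr m ρ' → f ρ' < f ρ := by
  classical
  rcases le_or_gt q k with hk | hk
  · refine ⟨fun _ => 0, ?_⟩
    rintro ρ ρ' h - ⟨_, ⟨j, rfl, hj⟩, -⟩ - -
    exact absurd (survivors_antitone m (show (j : ℕ) + 1 ≤ k by omega) h) hj.not_mem_survivors.1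
  · obtain ⟨f, hf⟩ := exists_rank_survivors m (k + 1)
    obtain ⟨B, hB⟩ : ∃ B, ∀ σ, f σ < B :=
      ⟨Finset.univ.sup f + 1, fun σ => Nat.lt_succ_of_le (Finset.le_sup (Finset.mem_univ σ))⟩
    -- Three levels: cells containing `k` have rank below `B`, cells without `k` that die by step
    -- `k` have rank `B`, the others lie above. A gradient step never moves to a higher level, and
    -- within the top and the bottom level `f` decreases.
    refine ⟨fun ρ => if (⟨k, hk⟩ : Fin q) ∈ ρ then f ρ else
      if ρ ∈ survivors m (k + 1) then B + 1 + f ρ else B, ?_⟩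
    rintro ρ ρ' hρ hρ' ⟨_, ⟨j, rfl, hj⟩, he, hne⟩ ⟨_, ⟨j', rfl, hj'⟩⟩ hg
    have hstep : GradientStep m ρ ρ' := ⟨_, ⟨j, rfl, hj⟩, he, hne⟩
    have hlow : IsLower m ρ' := ⟨_, ⟨j', rfl, hj'⟩⟩
    have stage : ∀ {i : Fin q} {σ}, σ ∈ survivors m k → PrunedIn m (survivors m i) i σ →
        i ≠ ⟨k, hk⟩ → (k + 1 : ℕ) ≤ i := by
      intro i σ hσ hi hik
      have : ¬ (i : ℕ) < k := fun h =>
        hi.not_mem_survivors.1 (survivors_antitone m (Nat.succ_le_of_lt h) hσ)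
      have : (i : ℕ) ≠ k := fun h => hik (Fin.ext h)
      omega
    have alive : ∀ {i : Fin q} {σ}, σ ∈ survivors m k → PrunedIn m (survivors m i) i σ →
        i ≠ ⟨k, hk⟩ → σ ∈ survivors m (k + 1) := fun hσ hi hik =>
      survivors_antitone m (stage hσ hi hik) hi.2.1
    have hr := fun h1 h2 => hf ρ ρ' h1 h2 hstep hlow hg
    by_cases hkρ : (⟨k, hk⟩ : Fin q) ∈ ρ
    · have hjk : j ≠ ⟨k, hk⟩ := fun h => hj.1 (h ▸ hkρ)
      have hkρ' : (⟨k, hk⟩ : Fin q) ∈ ρ' := by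
        -- If `k` were lost, the upper cell `insert j ρ` would equal `ρ' ∪ {k}` with equal degrees
        -- and both ends alive, so step `k` would have removed it; but it is pruned only later.
        by_contra hcon
        obtain ⟨i, hi, hi'⟩ := isEdge_iff.1 he
        have hik : i = ⟨k, hk⟩ := by
          by_contra hik
          exact hcon (hi' ▸ Finset.mem_erase.2 ⟨Ne.symm hik, Finset.mem_insert_of_mem hkρ⟩)
        have hins : insert (⟨k, hk⟩ : Fin q) ρ' = insert j ρ := by
          rw [hi', ← hik, Finset.insert_erase hi]
        have hμ : insert j ρ ∈ survivors m (k + 1) :=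
          survivors_antitone m (stage hρ hj hjk) hj.2.2.1
        have : PrunedIn m (survivors m (⟨k, hk⟩ : Fin q)) ⟨k, hk⟩ ρ' :=
          ⟨hcon, hρ', hins ▸ survivors_antitone m (Nat.le_succ k) hμ,
            by rw [hins, ← hj.2.2.2, hg]⟩
        exact this.not_mem_survivors.2 (hins ▸ hμ)
      have hjk' : j' ≠ ⟨k, hk⟩ := fun h => hj'.1 (h ▸ hkρ')
      simpa [hkρ, hkρ'] using hr (alive hρ hj hjk) (alive hρ' hj' hjk')
    · by_cases hjk : j = ⟨k, hk⟩
      · have hkρ' : (⟨k, hk⟩ : Fin q) ∈ ρ' := by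
          by_contra hcon
          obtain ⟨i, hi, hi'⟩ := isEdge_iff.1 he
          have hij : i = j := by
            by_contra hij
            exact hcon (hjk ▸ hi' ▸ Finset.mem_erase.2 ⟨Ne.symm hij, Finset.mem_insert_self _ _⟩)
          rw [hij, Finset.erase_insert hj.1] at hi'
          subst hi'
          exact hne ⟨j, rfl, hj⟩
        simp only [hkρ, hkρ', if_true, if_false]
        have := hB ρ'
        split_ifs <;> omega
      · have hkρ' : (⟨k, hk⟩ : Fin q) ∉ ρ' := fun h => by
          rcases Finset.mem_insert.1 (he.1 h) with h | h
          exacts [hjk h.symm, hkρ h]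
        have h1 := alive hρ hj hjk
        simp only [hkρ, hkρ', if_false, h1, if_true]
        by_cases h2 : ρ' ∈ survivors m (k + 1)
        · simpa [h2] using hr h1 h2
        · simp only [h2, if_false]
          omega
termination_by q - k

/-- A function that strictly decreases along gradient paths: the matching is acyclic. -/
theorem exists_rank (m : Fin q → (Fin n →₀ ℕ)) :
    ∃ f : Finset (Fin q) → ℕ, ∀ ρ ρ', GradientStep m ρ ρ' → IsLower m ρ' → f ρ' < f ρ := by
  obtain ⟨f, hf⟩ := exists_rank_survivors m 0
  obtain ⟨B, hB⟩ : ∃ B, ∀ σ, f σ < B :=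
    ⟨Finset.univ.sup f + 1, fun σ => Nat.lt_succ_of_le (Finset.le_sup (Finset.mem_univ σ))⟩
  -- Lexicographic rank: the total degree of the lcm first, then `f`, which is bounded by `B`.
  refine ⟨fun ρ => (gr m ρ).degree * B + f ρ, fun ρ ρ' h hl => ?_⟩
  rcases h.gr_le.eq_or_lt with heq | hlt
  · have := hf ρ ρ' trivial trivial h hl heq.symm
    simp only [heq]
    omega
  · have hd : (gr m ρ').degree < (gr m ρ).degree := by
      obtain ⟨c, hc⟩ := exists_add_of_le hlt.le
      have hc0 : c ≠ 0 := by
        rintro rfl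
        exact hlt.ne (by simpa using hc.symm)
      rw [hc, map_add]
      have : c.degree ≠ 0 := by simpa [Finsupp.degree_eq_zero_iff] using hc0
      omega
    have h1 : ((gr m ρ').degree + 1) * B ≤ (gr m ρ).degree * B := Nat.mul_le_mul_right _ hd
    have := hB ρ'
    simp only
    linarith [add_mul (gr m ρ').degree 1 B]

/-- Lower cells inject into upper cells, and critical cells are neither. This count shows that the
cutoff `2 ^ q` in `pathSum` loses no path. -/
theorem two_mul_card_isLower_add_le (m : Fin q → (Fin n →₀ ℕ)) [DecidablePred (IsLower m)]
    [DecidablePred (IsCritical m)] :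
    2 * (Finset.univ.filter (IsLower m)).card + (Finset.univ.filter (IsCritical m)).card ≤
      2 ^ q := by
  classical
  have h1 : (Finset.univ.filter (IsLower m)).card ≤ (Finset.univ.filter (IsUpper m)).card := by
    refine Finset.card_le_card_of_forall_subsingleton (fun σ τ => IsPruned m σ τ) ?_ ?_
    · intro σ hσ
      obtain ⟨τ, h⟩ := (Finset.mem_filter.1 hσ).2
      exact ⟨τ, by simpa using ⟨σ, h⟩, h⟩
    · rintro τ - σ ⟨-, h⟩ σ' ⟨-, h'⟩
      exact h.left_unique h'
  have h2 : (Finset.univ.filter (IsLower m)).card + (Finset.univ.filter (IsUpper m)).card +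
      (Finset.univ.filter (IsCritical m)).card ≤ 2 ^ q := by
    rw [← Finset.card_union_of_disjoint, ← Finset.card_union_of_disjoint]
    · exact (Finset.card_le_univ _).trans_eq (by simp)
    · rw [Finset.disjoint_left]
      intro σ h h'
      have := isCritical_iff.1 (Finset.mem_filter.1 h').2
      simp only [Finset.mem_union, Finset.mem_filter, Finset.mem_univ, true_and] at h
      tauto
    · rw [Finset.disjoint_left]
      intro σ h h'
      exact (Finset.mem_filter.1 h).2.not_isUpper (Finset.mem_filter.1 h').2
  omega

end Matching

/-! ### Gaussian elimination along a matching, in an abstract ring. -/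

section Perturbation

variable {A : Type*} [Ring A] {D D' P U C L H Z : A}

/-- Gaussian elimination in a ring: if `P` is the part of the differential `D` along a matching and
`-U` inverts `P`, then `p = 1 - D * S - S * D` with `S = -Z * U` is a projection that commutes with
`D` and is equivalent to the projection `C` on the unmatched part. -/
theorem exists_morse_projection (hD : D = D' + P) (hDD : D * D = 0) (hUP : U * P = -L)
    (hPU : P * U = -H) (hUU : U * U = 0) (h1 : C + L + H = 1) (hCU : C * U = 0)
    (hUC : U * C = 0) (hHU : H * U = 0) (hCC : C * C = C) (hHH : H * H = H) (hHC : H * C = 0)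
    (hZ : Z = 1 + U * D' * Z) (hZ' : Z = 1 + Z * (U * D')) :
    ∃ p : A, p = 1 + D * (Z * U) + Z * U * D ∧ D * p = p * D ∧ p * p = p ∧ p * C * p = p ∧
      C * p * C = C ∧ C * D * p * C = C * D * Z * C := by
  have hUZ : U * Z = U := by
    rw [hZ]
    simp only [mul_add, ← mul_assoc, hUU, mul_one, zero_mul, add_zero]
  have hCZ : C * Z = C := by
    rw [hZ]
    simp only [mul_add, ← mul_assoc, hCU, mul_one, zero_mul, add_zero]
  have hHZ : H * Z = H := by
    rw [hZ]
    simp only [mul_add, ← mul_assoc, hHU, mul_one, zero_mul, add_zero]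
  have hL : L = 1 - C - H := by rw [← h1]; abel
  -- `S` is the homotopy. From `S * S = 0` and `S * D * S = S` it follows that `p = 1 - D * S - S *
  -- D` kills `S` on both sides, hence is idempotent.
  obtain ⟨S, hS⟩ : ∃ S, S = -(Z * U) := ⟨_, rfl⟩
  have hSS : S * S = 0 := by
    rw [hS, neg_mul_neg, mul_assoc, ← mul_assoc U, hUZ, hUU, mul_zero]
  have hCS : C * S = 0 := by rw [hS, mul_neg, ← mul_assoc, hCZ, hCU, neg_zero]
  have hHS : H * S = 0 := by rw [hS, mul_neg, ← mul_assoc, hHZ, hHU, neg_zero]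
  have hSC : S * C = 0 := by rw [hS, neg_mul, mul_assoc, hUC, mul_zero, neg_zero]
  have hZ2 : Z * (U * D') = Z - 1 := by rw [eq_sub_iff_add_eq, add_comm]; exact hZ'.symm
  have hSD : S * D = 1 - Z * C - Z * H := by
    rw [hS, hD, neg_mul, mul_assoc, mul_add, hUP, mul_add, hZ2, hL]
    noncomm_ring
  have hSDS : S * D * S = S := by
    rw [hSD, sub_mul, sub_mul, mul_assoc, hCS, mul_assoc, hHS]
    simp
  have hPZ : P * Z = P - H * (D' * Z) := by
    conv_lhs => rw [hZ]
    rw [mul_add, mul_assoc U, ← mul_assoc P, hPU]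
    noncomm_ring
  have hHDS : H * D * S = H := by
    have e : D * S = -(D' * Z * U) - P * Z * U := by rw [hS, hD]; noncomm_ring
    rw [mul_assoc, e, hPZ, sub_mul, hPU, mul_sub, mul_sub, mul_neg, mul_neg, hHH]
    have e2 : H * (H * (D' * Z) * U) = H * (D' * Z * U) := by
      rw [← mul_assoc, ← mul_assoc H H, hHH, mul_assoc]
    rw [e2]
    abel
  have hSDL : S * D * L = L := by
    rw [hSD, hL]
    have e : (1 - Z * C - Z * H) * (1 - C - H) = 1 - C - H - Z * C + Z * (C * C) + Z * (C * H)
        - Z * H + Z * (H * C) + Z * (H * H) := by noncomm_ring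
    have hCH : C * H = 0 := by
      have : C * (U * P) = 0 := by rw [← mul_assoc, hCU, zero_mul]
      rw [hUP, hL] at this
      have e' : C * -(1 - C - H) = -C + C * C + C * H := by noncomm_ring
      rw [e', hCC] at this
      simpa using this
    rw [e, hCC, hCH, hHC, hHH]
    noncomm_ring
  obtain ⟨p, hp⟩ : ∃ p, p = 1 - D * S - S * D := ⟨_, rfl⟩
  have hDp : D * p = D - D * S * D := by
    have : D * p = D - D * D * S - D * S * D := by rw [hp]; noncomm_ring
    rw [this, hDD, zero_mul, sub_zero]
  have hpD : p * D = D - D * S * D := by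
    have : p * D = D - D * S * D - S * (D * D) := by rw [hp]; noncomm_ring
    rw [this, hDD, mul_zero, sub_zero]
  have hpS : p * S = 0 := by
    have : p * S = S - D * (S * S) - S * D * S := by rw [hp]; noncomm_ring
    rw [this, hSS, hSDS]
    simp
  have hSp : S * p = 0 := by
    have : S * p = S - S * D * S - S * S * D := by rw [hp]; noncomm_ring
    rw [this, hSS, hSDS]
    simp
  have hpp : p * p = p := by
    have : p * (1 - D * S - S * D) = p - p * D * S - p * S * D := by noncomm_ring
    rw [← hp] at this
    rw [this, hpS, hpD, ← hDp, mul_assoc, hpS]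
    simp
  refine ⟨p, ?_, hDp.trans hpD.symm, hpp, ?_, ?_, ?_⟩
  · rw [hp, hS]
    noncomm_ring
  -- Since `L = S * D * L` and `H = H * D * S`, the matched parts of `1 = C + L + H` vanish between
  -- two factors `p`.
  · have hpL : p * L * p = 0 := by
      rw [← hSDL, ← mul_assoc, ← mul_assoc, hpS]
      simp
    have hpH : p * H * p = 0 := by
      rw [← hHDS, mul_assoc, mul_assoc, hSp]
      simp
    have : p * C * p = p * p - p * L * p - p * H * p := by rw [hL]; noncomm_ring
    rw [this, hpp, hpL, hpH]
    simp
  · have : C * p * C = C * C - C * D * (S * C) - C * S * D * C := by rw [hp]; noncomm_ring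
    rw [this, hSC, hCS, hCC]
    simp
  · have : C * D * p * C = C * (D * p) * C := by noncomm_ring
    rw [this, hDp]
    have e : C * (D - D * S * D) * C = C * D * (1 - S * D) * C := by noncomm_ring
    rw [e, hSD]
    have e2 : C * D * (1 - (1 - Z * C - Z * H)) * C = C * D * (Z * (C * C) + Z * (H * C)) := by
      noncomm_ring
    rw [e2, hCC, hHC]
    noncomm_ring

end Perturbation

/-! ### The simplex, its signs and its contraction. -/

section Boundary

variable (K : Type*) [Field K] {q : ℕ}

/-- The sign `[σ : σ \ {i}]`. -/
def faceSign (σ : Finset (Fin q)) (i : Fin q) : K := (-1) ^ (σ.filter (· < i)).card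

variable {K}

theorem faceSign_mul_self (σ : Finset (Fin q)) (i : Fin q) :
    faceSign K σ i * faceSign K σ i = 1 := by
  rw [faceSign, ← mul_pow]
  simp

/-- Deleting the smaller index lowers the position of the larger one by one, while deleting the
larger does not affect the smaller. -/
theorem faceSign_swap {σ : Finset (Fin q)} {i k : Fin q} (hi : i ∈ σ) (hk : k ∈ σ)
    (hik : i ≠ k) : faceSign K σ i * faceSign K (σ.erase i) k =
      -(faceSign K σ k * faceSign K (σ.erase k) i) := by
  have key : ∀ {i k : Fin q}, i ∈ σ → i < k → faceSign K σ i * faceSign K (σ.erase i) k =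
      -(faceSign K σ k * faceSign K (σ.erase k) i) := by
    intro i k hi hik
    have h1 : (σ.erase k).filter (· < i) = σ.filter (· < i) := by
      rw [Finset.filter_erase, Finset.erase_eq_of_notMem]
      simp [hik.le]
    have h2 : ((σ.erase i).filter (· < k)).card + 1 = (σ.filter (· < k)).card := by
      rw [Finset.filter_erase, Finset.card_erase_add_one]
      simp [hi, hik]
    simp only [faceSign, h1, ← h2, pow_succ]
    ring
  rcases lt_or_gt_of_ne hik with h | h
  · exact key hi h
  · rw [key hk h, neg_neg]

theorem incidence_def (σ τ : Finset (Fin q)) :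
    incidence K σ τ = ∑ i ∈ σ, if τ = σ.erase i then faceSign K σ i else 0 := rfl

theorem incidence_erase {σ : Finset (Fin q)} {i : Fin q} (hi : i ∈ σ) :
    incidence K σ (σ.erase i) = faceSign K σ i := by
  rw [incidence_def, Finset.sum_eq_single_of_mem i hi, if_pos rfl]
  intro k hk hki
  rw [if_neg]
  intro h
  have : k ∈ σ.erase i := Finset.mem_erase.2 ⟨hki, hk⟩
  rw [h] at this
  exact Finset.notMem_erase _ _ this

theorem isEdge_of_incidence_ne_zero {σ τ : Finset (Fin q)} (h : incidence K σ τ ≠ 0) :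
    IsEdge σ τ := by
  obtain ⟨i, hi, h⟩ := Finset.exists_ne_zero_of_sum_ne_zero h
  refine isEdge_iff.2 ⟨i, hi, ?_⟩
  by_contra hne
  exact h (if_neg hne)

theorem incidence_ne_zero {σ τ : Finset (Fin q)} (h : IsEdge σ τ) : incidence K σ τ ≠ 0 := by
  obtain ⟨i, hi, rfl⟩ := isEdge_iff.1 h
  rw [incidence_erase hi]
  intro h0
  simpa [h0] using faceSign_mul_self (K := K) σ i

theorem sum_incidence_mul (σ : Finset (Fin q)) (g : Finset (Fin q) → K) :
    ∑ ρ, incidence K σ ρ * g ρ = ∑ i ∈ σ, faceSign K σ i * g (σ.erase i) := by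
  simp_rw [incidence_def, Finset.sum_mul, ite_mul, zero_mul]
  rw [Finset.sum_comm]
  simp

variable (K q) in
/-- The boundary of the simplex on `Fin q`, as a matrix acting on row vectors. -/
def boundary : Matrix (Finset (Fin q)) (Finset (Fin q)) K := Matrix.of (incidence K)

theorem boundary_mul_boundary : boundary K q * boundary K q = 0 := by
  ext σ τ
  simp only [Matrix.mul_apply, boundary, Matrix.of_apply, Matrix.zero_apply]
  rw [sum_incidence_mul]
  simp_rw [incidence_def, Finset.mul_sum, Finset.sum_sigma']
  -- Deleting `i` and then `k` cancels against deleting `k` and then `i`.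
  refine Finset.sum_involution (fun x _ => ⟨x.2, x.1⟩) ?_ ?_ ?_ ?_
  · rintro ⟨i, k⟩ h
    simp only [Finset.mem_sigma, Finset.mem_erase] at h
    simp only [Finset.erase_right_comm (a := k) (b := i)]
    split_ifs
    · rw [faceSign_swap h.1 h.2.2 (Ne.symm h.2.1), neg_add_cancel]
    · simp
  · rintro ⟨i, k⟩ h _ heq
    simp only [Finset.mem_sigma, Finset.mem_erase] at h
    simp only [Sigma.mk.injEq] at heq
    exact h.2.1 heq.1
  · rintro ⟨i, k⟩ h
    simp only [Finset.mem_sigma, Finset.mem_erase] at h ⊢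
    exact ⟨h.2.2, Ne.symm h.2.1, h.1⟩
  · rintro ⟨i, k⟩ _
    rfl

variable (K) in
/-- The contraction of the simplex to the vertex `a`. -/
def cone (a : Fin q) : Matrix (Finset (Fin q)) (Finset (Fin q)) K :=
  Matrix.of fun σ τ => if a ∉ σ ∧ τ = insert a σ then faceSign K τ a else 0

/-- Inserting `a` is a contracting homotopy. The empty face counts as a cell, so the identity holds
without an exception in the lowest degree. -/
theorem boundary_mul_cone_add (a : Fin q) :
    boundary K q * cone K a + cone K a * boundary K q = 1 := by
  ext σ τ
  simp only [Matrix.add_apply, Matrix.mul_apply, boundary, cone, Matrix.of_apply]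
  rw [sum_incidence_mul]
  by_cases ha : a ∈ σ
  · rw [Finset.sum_eq_single_of_mem a ha]
    · simp only [Finset.notMem_erase, not_false_eq_true, Finset.insert_erase ha, true_and, ha,
        not_true_eq_false, false_and, if_false, zero_mul, Finset.sum_const_zero, add_zero,
        Matrix.one_apply]
      by_cases h : σ = τ
      · subst h
        simp [faceSign_mul_self]
      · simp [h, Ne.symm h]
    · intro i hi hia
      rw [if_neg, mul_zero]
      exact fun h => h.1 (Finset.mem_erase.2 ⟨Ne.symm hia, ha⟩)
  · have h1 : ∀ i ∈ σ, insert a (σ.erase i) = (insert a σ).erase i := fun i hi =>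
      (Finset.erase_insert_of_ne (by rintro rfl; exact ha hi)).symm
    have h2 : ∑ x, (if a ∉ σ ∧ x = insert a σ then faceSign K x a else 0) * incidence K x τ =
        faceSign K (insert a σ) a * incidence K (insert a σ) τ := by
      simp [ha]
    rw [h2, incidence_def, Finset.sum_insert ha, Finset.erase_insert ha, mul_add, Finset.mul_sum,
      add_left_comm, ← Finset.sum_add_distrib, Finset.sum_eq_zero, add_zero, Matrix.one_apply]
    · by_cases h : σ = τ
      · subst h
        simp [faceSign_mul_self]
      · simp [h, Ne.symm h]
    · intro i hi
      have hai : a ≠ i := fun h => ha (h ▸ hi)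
      have hm : a ∉ σ.erase i := fun h => ha (Finset.mem_of_mem_erase h)
      simp only [hm, not_false_eq_true, true_and, h1 i hi]
      by_cases h : τ = (insert a σ).erase i
      · subst h
        simp only [if_true]
        have hs := faceSign_swap (K := K) (Finset.mem_insert_of_mem (b := a) hi)
          (Finset.mem_insert_self a σ) (Ne.symm hai)
        rw [Finset.erase_insert ha] at hs
        have e1 := faceSign_mul_self (K := K) (insert a σ) a
        have e2 := faceSign_mul_self (K := K) (insert a σ) i
        linear_combination (faceSign K (insert a σ) i * faceSign K σ i) * hs -
          faceSign K σ i * faceSign K ((insert a σ).erase i) a * e2 -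
          faceSign K (insert a σ) a * faceSign K (insert a σ) i *
            faceSign_mul_self (K := K) σ i
      · simp [h]

end Boundary

/-! ### Matrix powers as sums over walks. -/

theorem sum_prod_walk_eq_pow_apply {V R : Type*} [Fintype V] [DecidableEq V] [CommRing R]
    (N : Matrix V V R) (l : ℕ) (σ τ : V) :
    ∑ P : Fin (l + 1) → V, (if P 0 = σ ∧ P (Fin.last l) = τ then
      ∏ k : Fin l, N (P k.castSucc) (P k.succ) else 0) = (N ^ l) σ τ := by
  induction l generalizing σ with
  | zero =>
    rw [pow_zero, Matrix.one_apply]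
    simp only [Finset.univ_eq_empty, Finset.prod_empty, Nat.reduceAdd]
    rw [← (Equiv.funUnique (Fin 1) V).symm.sum_comp]
    simp only [Equiv.funUnique_symm_apply, uniqueElim_const]
    by_cases h : σ = τ
    · subst h; simp
    · rw [if_neg h]
      refine Finset.sum_eq_zero fun x _ => if_neg ?_
      rintro ⟨rfl, rfl⟩
      exact h rfl
  | succ l ih =>
    rw [pow_succ', Matrix.mul_apply, ← (Fin.consEquiv fun _ => V).sum_comp,
      Fintype.sum_prod_type]
    simp only [Fin.consEquiv_apply, Fin.cons_zero, ← Fin.succ_last, Fin.cons_succ,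
      Fin.prod_univ_succ, Fin.castSucc_zero, ← Fin.succ_castSucc]
    rw [Finset.sum_eq_single σ]
    · simp only [true_and]
      simp_rw [← ih, Finset.mul_sum]
      rw [Finset.sum_comm]
      refine Finset.sum_congr rfl fun P _ => ?_
      by_cases h : P (Fin.last l) = τ
      · simp [h]
      · simp [h]
    · intro x _ hx
      simp [hx]
    · simp

/-- A nonzero entry of `A ^ k` contains a walk whose `k` starting points of steps lie in `s` and are
distinct, because `f` decreases along it. Only the last vertex may lie outside `s`, so no decrease
is demanded there. -/
theorem le_card_of_pow_apply_ne_zero {V R : Type*} [Fintype V] [DecidableEq V] [CommRing R] (A : Matrix V V R)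
    (s : Finset V) (f : V → ℕ) (hs : ∀ x y, A x y ≠ 0 → x ∈ s)
    (hf : ∀ x y, A x y ≠ 0 → y ∈ s → f y < f x) (k : ℕ) (x y : V) (h : (A ^ k) x y ≠ 0) :
    k ≤ s.card := by
  suffices ∃ t ⊆ s, t.card = k ∧ ∀ z ∈ t, f z ≤ f x by
    obtain ⟨t, hts, rfl, -⟩ := this
    exact Finset.card_le_card hts
  induction k generalizing x with
  | zero => exact ⟨∅, by simp, rfl, by simp⟩
  | succ k ih =>
    rw [pow_succ', Matrix.mul_apply] at h
    obtain ⟨z, -, hz⟩ := Finset.exists_ne_zero_of_sum_ne_zero h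
    have hxz := left_ne_zero_of_mul hz
    have hzy := right_ne_zero_of_mul hz
    obtain ⟨t, hts, htk, htf⟩ := ih z hzy
    have hlt : ∀ w ∈ t, f w < f x := by
      intro w hw
      by_cases hzs : z ∈ s
      · exact (htf w hw).trans_lt (hf x z hxz hzs)
      · exfalso
        cases k with
        | zero => simp [Finset.card_eq_zero.1 htk] at hw
        | succ k =>
          rw [pow_succ', Matrix.mul_apply] at hzy
          obtain ⟨u, -, hu⟩ := Finset.exists_ne_zero_of_sum_ne_zero hzy
          exact hzs (hs z u (left_ne_zero_of_mul hu))
    refine ⟨insert x t, Finset.insert_subset (hs x z hxz) hts, ?_, ?_⟩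
    · rw [Finset.card_insert_of_notMem fun hx => (hlt x hx).false, htk]
    · intro w hw
      rcases Finset.mem_insert.1 hw with rfl | hw
      exacts [le_rfl, (hlt w hw).le]

/-! ### The Morse differential as a scalar matrix acting on row vectors. -/

section MorseMatrices

variable (K : Type*) [Field K] {q n : ℕ} (m : Fin q → (Fin n →₀ ℕ))

open Classical in
/-- The part of the boundary along the edges that are not pruned. -/
noncomputable def unprunedBoundary : Matrix (Finset (Fin q)) (Finset (Fin q)) K :=
  Matrix.of fun σ τ => if IsPruned m τ σ then 0 else incidence K σ τ

open Classical in
/-- The part of the boundary along the pruned edges. -/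
noncomputable def prunedBoundary : Matrix (Finset (Fin q)) (Finset (Fin q)) K :=
  Matrix.of fun σ τ => if IsPruned m τ σ then incidence K σ τ else 0

open Classical in
/-- The weights of the reversed edges. -/
noncomputable def reversal : Matrix (Finset (Fin q)) (Finset (Fin q)) K :=
  Matrix.of fun σ τ => if IsPruned m σ τ then -(1 / incidence K τ σ) else 0

open Classical in
/-- The projection to the span of the cells that satisfy `p`. -/
noncomputable def cellProj (p : Finset (Fin q) → Prop) :
    Matrix (Finset (Fin q)) (Finset (Fin q)) K :=
  Matrix.diagonal fun σ => if p σ then 1 else 0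

/-- The sum of the weights of the gradient paths that alternate between reversed edges and edges
that are not pruned. -/
noncomputable def gradientFlow : Matrix (Finset (Fin q)) (Finset (Fin q)) K :=
  ∑ k ∈ Finset.range (2 ^ q), (reversal K m * unprunedBoundary K m) ^ k

variable {K}

theorem cellProj_mul_apply (p : Finset (Fin q) → Prop)
    (A : Matrix (Finset (Fin q)) (Finset (Fin q)) K) (σ τ : Finset (Fin q)) [Decidable (p σ)] :
    (cellProj K p * A) σ τ = if p σ then A σ τ else 0 := by
  rw [cellProj, Matrix.diagonal_mul]
  split_ifs <;> simp

theorem mul_cellProj_apply (p : Finset (Fin q) → Prop)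
    (A : Matrix (Finset (Fin q)) (Finset (Fin q)) K) (σ τ : Finset (Fin q)) [Decidable (p τ)] :
    (A * cellProj K p) σ τ = if p τ then A σ τ else 0 := by
  rw [cellProj, Matrix.mul_diagonal]
  split_ifs <;> simp

theorem cellProj_mul_eq_zero {p : Finset (Fin q) → Prop}
    {A : Matrix (Finset (Fin q)) (Finset (Fin q)) K} (h : ∀ σ τ, A σ τ ≠ 0 → ¬ p σ) :
    cellProj K p * A = 0 := by
  classical
  ext σ τ
  rw [cellProj_mul_apply, Matrix.zero_apply, ite_eq_right_iff]
  intro hp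
  by_contra hne
  exact h σ τ hne hp

theorem mul_cellProj_eq_zero {p : Finset (Fin q) → Prop}
    {A : Matrix (Finset (Fin q)) (Finset (Fin q)) K} (h : ∀ σ τ, A σ τ ≠ 0 → ¬ p τ) :
    A * cellProj K p = 0 := by
  classical
  ext σ τ
  rw [mul_cellProj_apply, Matrix.zero_apply, ite_eq_right_iff]
  intro hp
  by_contra hne
  exact h σ τ hne hp

theorem cellProj_mul_self (p : Finset (Fin q) → Prop) :
    cellProj K p * cellProj K p = cellProj K p := by
  rw [cellProj, Matrix.diagonal_mul_diagonal]
  congr 1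
  ext σ
  split_ifs <;> simp

variable {m}

theorem reversal_ne_zero {σ τ : Finset (Fin q)} (h : reversal K m σ τ ≠ 0) : IsPruned m σ τ := by
  by_contra hn
  exact h (by simp [reversal, hn])

theorem unprunedBoundary_ne_zero {σ τ : Finset (Fin q)} (h : unprunedBoundary K m σ τ ≠ 0) :
    IsEdge σ τ ∧ ¬ IsPruned m τ σ := by
  have hn : ¬ IsPruned m τ σ := fun hn => h (by simp [unprunedBoundary, hn])
  refine ⟨isEdge_of_incidence_ne_zero (K := K) ?_, hn⟩
  simpa [unprunedBoundary, hn] using h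

theorem gradientStep_of_ne_zero {σ τ : Finset (Fin q)}
    (h : (reversal K m * unprunedBoundary K m) σ τ ≠ 0) : GradientStep m σ τ := by
  rw [Matrix.mul_apply] at h
  obtain ⟨μ, -, hμ⟩ := Finset.exists_ne_zero_of_sum_ne_zero h
  have h2 := unprunedBoundary_ne_zero (right_ne_zero_of_mul hμ)
  exact ⟨μ, reversal_ne_zero (left_ne_zero_of_mul hμ), h2.1, h2.2⟩

theorem GradientStep.isLower {σ τ : Finset (Fin q)} (h : GradientStep m σ τ) : IsLower m σ := by
  obtain ⟨μ, h, -⟩ := h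
  exact ⟨μ, h⟩

variable (m)

theorem boundary_eq : boundary K q = unprunedBoundary K m + prunedBoundary K m := by
  ext σ τ
  simp only [boundary, unprunedBoundary, prunedBoundary, Matrix.add_apply, Matrix.of_apply]
  split_ifs <;> simp

theorem reversal_mul_prunedBoundary :
    reversal K m * prunedBoundary K m = -cellProj K (IsLower m) := by
  classical
  ext σ τ
  rw [Matrix.mul_apply, Matrix.neg_apply, cellProj, Matrix.diagonal_apply]
  by_cases hσ : IsLower m σ
  · obtain ⟨μ, hμ⟩ := hσ
    rw [Finset.sum_eq_single μ]
    · by_cases h : σ = τ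
      · subst h
        have := incidence_ne_zero (K := K) hμ.isEdge
        have hl : IsLower m σ := ⟨μ, hμ⟩
        simp [reversal, prunedBoundary, hμ, hl, this]
      · have : ¬ IsPruned m τ μ := fun h' => h (hμ.left_unique h')
        simp [prunedBoundary, this, h]
    · intro ν _ hν
      have : ¬ IsPruned m σ ν := fun h' => hν (h'.right_unique hμ)
      simp [reversal, this]
    · simp
  · have : ∀ μ, ¬ IsPruned m σ μ := fun μ h => hσ ⟨μ, h⟩
    simp [reversal, this, hσ]

theorem prunedBoundary_mul_reversal :
    prunedBoundary K m * reversal K m = -cellProj K (IsUpper m) := by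
  classical
  ext σ τ
  rw [Matrix.mul_apply, Matrix.neg_apply, cellProj, Matrix.diagonal_apply]
  by_cases hσ : IsUpper m σ
  · obtain ⟨μ, hμ⟩ := hσ
    rw [Finset.sum_eq_single μ]
    · by_cases h : σ = τ
      · subst h
        have := incidence_ne_zero (K := K) hμ.isEdge
        have hl : IsUpper m σ := ⟨μ, hμ⟩
        simp [reversal, prunedBoundary, hμ, hl, this]
      · have : ¬ IsPruned m μ τ := fun h' => h (hμ.right_unique h')
        simp [reversal, this, h]
    · intro ν _ hν
      have : ¬ IsPruned m ν σ := fun h' => hν (h'.left_unique hμ)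
      simp [prunedBoundary, this]
    · simp
  · have : ∀ μ, ¬ IsPruned m μ σ := fun μ h => hσ ⟨μ, h⟩
    simp [prunedBoundary, this, hσ]

theorem cellProj_add :
    cellProj K (IsCritical m) + cellProj K (IsLower m) + cellProj K (IsUpper m) = 1 := by
  classical
  rw [cellProj, cellProj, cellProj, Matrix.diagonal_add, Matrix.diagonal_add, ← Matrix.diagonal_one]
  congr 1
  ext σ
  have h1 := isCritical_iff (m := m) (σ := σ)
  by_cases hl : IsLower m σ
  · have := hl.not_isUpper
    have : ¬ IsCritical m σ := fun h => (h1.1 h).1 hl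
    simp [*]
  · by_cases hu : IsUpper m σ
    · have : ¬ IsCritical m σ := fun h => (h1.1 h).2 hu
      simp [*]
    · have : IsCritical m σ := h1.2 ⟨hl, hu⟩
      simp [*]

theorem pow_apply_ne_zero_le {σ τ : Finset (Fin q)} {k : ℕ} [DecidablePred (IsLower m)]
    (h : ((reversal K m * unprunedBoundary K m) ^ k) σ τ ≠ 0) :
    k ≤ (Finset.univ.filter (IsLower m)).card := by
  classical
  obtain ⟨f, hf⟩ := exists_rank m
  refine le_card_of_pow_apply_ne_zero _ _ f ?_ ?_ k σ τ h
  · intro x y hxy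
    simpa using (gradientStep_of_ne_zero hxy).isLower
  · intro x y hxy hy
    exact hf x y (gradientStep_of_ne_zero hxy) (by simpa using hy)

theorem pow_two_pow_eq_zero : (reversal K m * unprunedBoundary K m) ^ 2 ^ q = 0 := by
  classical
  ext σ τ
  by_contra h
  have h1 := pow_apply_ne_zero_le m h
  have h2 := two_mul_card_isLower_add_le m
  have h3 : 0 < 2 ^ q := Nat.two_pow_pos q
  omega

theorem gradientFlow_eq :
    gradientFlow K m = 1 + reversal K m * unprunedBoundary K m * gradientFlow K m := by
  have h := mul_neg_geom_sum (reversal K m * unprunedBoundary K m) (2 ^ q)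
  rw [pow_two_pow_eq_zero, sub_zero, sub_mul, one_mul, sub_eq_iff_eq_add] at h
  exact h

theorem gradientFlow_eq' :
    gradientFlow K m = 1 + gradientFlow K m * (reversal K m * unprunedBoundary K m) := by
  have h := geom_sum_mul_neg (reversal K m * unprunedBoundary K m) (2 ^ q)
  rw [pow_two_pow_eq_zero, sub_zero, mul_sub, mul_one, sub_eq_iff_eq_add] at h
  exact h

variable (K) in
/-- The differential of the Morse complex on all cells, extended by zero. -/
noncomputable def morseMatrix : Matrix (Finset (Fin q)) (Finset (Fin q)) K :=
  cellProj K (IsCritical m) * boundary K q * gradientFlow K m * cellProj K (IsCritical m)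

theorem exists_projection : ∃ p : Matrix (Finset (Fin q)) (Finset (Fin q)) K,
    p = 1 + boundary K q * (gradientFlow K m * reversal K m) +
      gradientFlow K m * reversal K m * boundary K q ∧
    boundary K q * p = p * boundary K q ∧ p * p = p ∧ p * cellProj K (IsCritical m) * p = p ∧
    cellProj K (IsCritical m) * p * cellProj K (IsCritical m) = cellProj K (IsCritical m) ∧
    cellProj K (IsCritical m) * boundary K q * p * cellProj K (IsCritical m) =
      morseMatrix K m := by
  refine exists_morse_projection (boundary_eq m) boundary_mul_boundary
    (reversal_mul_prunedBoundary m) (prunedBoundary_mul_reversal m) ?_ (cellProj_add m) ?_ ?_ ?_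
    (cellProj_mul_self _) (cellProj_mul_self _) ?_ (gradientFlow_eq m) (gradientFlow_eq' m)
  · ext σ τ
    rw [Matrix.mul_apply, Matrix.zero_apply]
    refine Finset.sum_eq_zero fun μ _ => ?_
    by_contra h
    exact (reversal_ne_zero (left_ne_zero_of_mul h)).not_isPruned_left
      (reversal_ne_zero (right_ne_zero_of_mul h))
  · exact cellProj_mul_eq_zero fun σ τ h hc => (hc τ).1 (reversal_ne_zero h)
  · exact mul_cellProj_eq_zero fun σ τ h hc => (hc σ).2 (reversal_ne_zero h)
  · exact cellProj_mul_eq_zero fun σ τ h hu =>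
      IsLower.not_isUpper ⟨τ, reversal_ne_zero h⟩ hu
  · refine mul_cellProj_eq_zero fun σ τ h hc => ?_
    rw [cellProj, Matrix.diagonal_apply] at h
    split_ifs at h with h1 h2
    · exact (isCritical_iff.1 hc).2 (h1 ▸ h2)
    · exact h rfl
    · exact h rfl

end MorseMatrices

/-! ### Matrices with restricted support. -/

section Supported

variable {V R : Type*} [CommRing R]

/-- The nonzero entries of a matrix are at positions that satisfy `r`. -/
def Supported (r : V → V → Prop) (A : Matrix V V R) : Prop := ∀ x y, A x y ≠ 0 → r x y

variable {r s t : V → V → Prop} {A B : Matrix V V R}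

theorem Supported.mul [Fintype V] (hA : Supported r A) (hB : Supported s B)
    (h : ∀ x y z, r x y → s y z → t x z) : Supported t (A * B) := by
  intro x z hxz
  rw [Matrix.mul_apply] at hxz
  obtain ⟨y, -, hy⟩ := Finset.exists_ne_zero_of_sum_ne_zero hxz
  exact h x y z (hA x y (left_ne_zero_of_mul hy)) (hB y z (right_ne_zero_of_mul hy))

theorem Supported.add (hA : Supported r A) (hB : Supported r B) : Supported r (A + B) := by
  intro x y h
  by_contra hn
  have h1 : A x y = 0 := by_contra fun h' => hn (hA x y h')
  have h2 : B x y = 0 := by_contra fun h' => hn (hB x y h')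
  exact h (by simp [h1, h2])

theorem Supported.sum {ι : Type*} {f : ι → Matrix V V R} {S : Finset ι}
    (h : ∀ i ∈ S, Supported r (f i)) : Supported r (∑ i ∈ S, f i) := by
  intro x y hxy
  rw [Matrix.sum_apply] at hxy
  obtain ⟨i, hi, hne⟩ := Finset.exists_ne_zero_of_sum_ne_zero hxy
  exact h i hi x y hne

theorem Supported.one [DecidableEq V] (h : ∀ x, r x x) : Supported r (1 : Matrix V V R) := by
  intro x y hxy
  rw [Matrix.one_apply] at hxy
  by_cases h' : x = y
  · exact h' ▸ h x
  · exact absurd (if_neg h') hxy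

theorem Supported.pow [Fintype V] [DecidableEq V] (hA : Supported r A) (h : ∀ x, r x x)
    (htrans : ∀ x y z, r x y → r y z → r x z) (k : ℕ) : Supported r (A ^ k) := by
  induction k with
  | zero => exact pow_zero A ▸ Supported.one h
  | succ k ih => exact pow_succ A k ▸ ih.mul hA htrans

theorem Supported.vecMul_eq_zero [Fintype V] {p : V → Prop} (hA : Supported r A) {v : V → R}
    (hv : ∀ x, v x ≠ 0 → p x) (y : V) (h : ∀ x, p x → ¬ r x y) : Matrix.vecMul v A y = 0 := by
  rw [Matrix.vecMul, dotProduct]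
  refine Finset.sum_eq_zero fun x _ => ?_
  by_contra hn
  exact h x (hv x (left_ne_zero_of_mul hn)) (hA x y (right_ne_zero_of_mul hn))

end Supported

/-! ### Compatibility with multidegree and cardinality. -/

section Grading

variable {K : Type*} [Field K] {q n : ℕ} (m : Fin q → (Fin n →₀ ℕ))

/-- The relation between cells of which the second one has a smaller multidegree. -/
def GrLE (σ τ : Finset (Fin q)) : Prop := gr m τ ≤ gr m σ

theorem supported_boundary : Supported IsEdge (boundary K q) :=
  fun _ _ h => isEdge_of_incidence_ne_zero h

theorem supported_reversal : Supported (IsPruned m) (reversal K m) :=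
  fun _ _ h => reversal_ne_zero h

theorem supported_gradientFlow :
    Supported (fun σ τ => GrLE m σ τ ∧ σ.card = τ.card) (gradientFlow K m) := by
  refine Supported.sum fun k _ => Supported.pow ?_ ?_ ?_ k
  · intro σ τ h
    have hs := gradientStep_of_ne_zero h
    obtain ⟨μ, h1, h2, -⟩ := id hs
    exact ⟨hs.gr_le, by have := h1.isEdge.2; have := h2.2; omega⟩
  · exact fun σ => ⟨le_refl (gr m σ), rfl⟩
  · exact fun σ τ ρ h1 h2 => ⟨le_trans h2.1 h1.1, h1.2.trans h2.2⟩

theorem supported_morseMatrix : Supported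
    (fun σ τ => IsCritical m σ ∧ IsCritical m τ ∧ GrLE m σ τ ∧ σ.card = τ.card + 1)
    (morseMatrix K m) := by
  classical
  intro σ τ h
  rw [morseMatrix, mul_cellProj_apply, mul_assoc, cellProj_mul_apply] at h
  by_cases hτ : IsCritical m τ
  · by_cases hσ : IsCritical m σ
    · rw [if_pos hτ, if_pos hσ] at h
      refine ⟨hσ, hτ, (supported_boundary.mul (t := fun σ τ => GrLE m σ τ ∧
        σ.card = τ.card + 1) (supported_gradientFlow m) ?_) σ τ h⟩
      rintro x y z hxy ⟨h1, h2⟩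
      exact ⟨h1.trans (hxy.gr_le m), h2 ▸ hxy.2⟩
    · simp [hτ, hσ] at h
  · simp [hτ] at h

end Grading

/-! ### Path sums agree with the gradient flow. -/

section PathSum

variable {K : Type*} [Field K] {q n : ℕ} (m : Fin q → (Fin n →₀ ℕ))

open Classical in
theorem ite_morseEdge (σ τ : Finset (Fin q)) :
    (if MorseEdge m σ τ then edgeWeight K m σ τ else 0) =
      (unprunedBoundary K m + reversal K m) σ τ := by
  simp only [Matrix.add_apply, unprunedBoundary, reversal, Matrix.of_apply, edgeWeight, MorseEdge]
  by_cases h : IsPruned m σ τ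
  · have h0 : incidence K σ τ = 0 := by
      by_contra hne
      have := (isEdge_of_incidence_ne_zero hne).2
      have := h.isEdge.2
      omega
    simp [h, h0]
  · by_cases h' : IsPruned m τ σ
    · simp [h, h']
    · by_cases he : IsEdge σ τ
      · simp [h, h', he]
      · have h0 : incidence K σ τ = 0 := by
          by_contra hne
          exact he (isEdge_of_incidence_ne_zero hne)
        simp [h, h', he, h0]

theorem pathSum_eq (σ τ : Finset (Fin q)) :
    pathSum K m σ τ = ∑ l ∈ Finset.range (2 ^ q),
      ((unprunedBoundary K m + reversal K m) ^ l) σ τ := by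
  classical
  rw [pathSum]
  refine Finset.sum_congr rfl fun l _ => ?_
  rw [← sum_prod_walk_eq_pow_apply, Finset.sum_filter]
  refine Finset.sum_congr (by congr!) fun P _ => ?_
  simp_rw [← ite_morseEdge]
  by_cases h : P 0 = σ ∧ P (Fin.last l) = τ
  · by_cases h' : ∀ k : Fin l, MorseEdge m (P k.castSucc) (P k.succ)
    · simp [h, h']
    · rw [if_neg fun hc => h' hc.2.2, if_pos h]
      push Not at h'
      obtain ⟨k, hk⟩ := h'
      exact (Finset.prod_eq_zero (Finset.mem_univ k) (if_neg hk)).symm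
  · rw [if_neg h, if_neg fun hc => h ⟨hc.1, hc.2.1⟩]

variable {m}

/-- An up step ends in an upper cell, from which no second up step is possible. So a walk starting
below `τ` could reach the size of `τ` only in an upper cell, never in the critical cell `τ`. -/
theorem pow_apply_eq_zero_of_isCritical {τ : Finset (Fin q)} (hτ : IsCritical m τ) (l : ℕ)
    (ρ : Finset (Fin q)) (h : ρ.card < τ.card ∨ ρ.card = τ.card ∧ ρ ≠ τ ∧ ¬ IsLower m ρ) :
    ((unprunedBoundary K m + reversal K m) ^ l) ρ τ = 0 := by
  induction l generalizing ρ with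
  | zero =>
    rw [pow_zero, Matrix.one_apply, if_neg]
    rintro rfl
    rcases h with h | h
    exacts [h.false, h.2.1 rfl]
  | succ l ih =>
    rw [pow_succ', Matrix.mul_apply]
    refine Finset.sum_eq_zero fun ρ' _ => ?_
    rw [Matrix.add_apply, add_mul]
    have h1 : unprunedBoundary K m ρ ρ' *
        ((unprunedBoundary K m + reversal K m) ^ l) ρ' τ = 0 := by
      by_cases h0 : unprunedBoundary K m ρ ρ' = 0
      · rw [h0, zero_mul]
      · have := (unprunedBoundary_ne_zero h0).1.2
        rw [ih ρ' (Or.inl (by omega)), mul_zero]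
    have h2 : reversal K m ρ ρ' * ((unprunedBoundary K m + reversal K m) ^ l) ρ' τ = 0 := by
      by_cases h0 : reversal K m ρ ρ' = 0
      · rw [h0, zero_mul]
      · have hp := reversal_ne_zero h0
        have hc := hp.isEdge.2
        have hlt : ρ.card < τ.card := by
          rcases h with h | h
          exacts [h, absurd ⟨ρ', hp⟩ h.2.2]
        rw [ih ρ', mul_zero]
        rcases (show ρ'.card ≤ τ.card by omega).lt_or_eq with h' | h'
        · exact Or.inl h'
        · refine Or.inr ⟨h', ?_, fun hl => hl.not_isUpper ⟨ρ, hp⟩⟩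
          rintro rfl
          exact (hτ ρ).2 hp
    rw [h1, h2, add_zero]

/-- Of the possible first two steps only up-down survives: a walk that starts downwards cannot
return to `τ`, and two consecutive up steps do not exist. -/
theorem pow_add_two_apply {τ : Finset (Fin q)} (hτ : IsCritical m τ) (l : ℕ)
    {ρ : Finset (Fin q)} (h : ρ.card = τ.card) :
    ((unprunedBoundary K m + reversal K m) ^ (l + 2)) ρ τ =
      ∑ ρ', (reversal K m * unprunedBoundary K m) ρ ρ' *
        ((unprunedBoundary K m + reversal K m) ^ l) ρ' τ := by
  set N := unprunedBoundary K m + reversal K m with hN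
  have e : N ^ (l + 2) = unprunedBoundary K m * N ^ (l + 1) +
      (reversal K m * reversal K m) * N ^ l +
      reversal K m * unprunedBoundary K m * N ^ l := by
    have e0 : ∀ X, N * X = unprunedBoundary K m * X + reversal K m * X := fun X => by
      rw [hN, add_mul]
    rw [pow_succ', e0, pow_succ' N l, e0 (N ^ l), mul_add (reversal K m), mul_assoc (reversal K m),
      mul_assoc (reversal K m)]
    abel
  have hUU : reversal K m * reversal K m = 0 := by
    ext x y
    rw [Matrix.mul_apply, Matrix.zero_apply]
    refine Finset.sum_eq_zero fun μ _ => ?_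
    by_contra h
    exact (reversal_ne_zero (left_ne_zero_of_mul h)).not_isPruned_left
      (reversal_ne_zero (right_ne_zero_of_mul h))
  have h0 : (unprunedBoundary K m * N ^ (l + 1)) ρ τ = 0 := by
    rw [Matrix.mul_apply]
    refine Finset.sum_eq_zero fun ρ' _ => ?_
    by_cases h0 : unprunedBoundary K m ρ ρ' = 0
    · rw [h0, zero_mul]
    · have := (unprunedBoundary_ne_zero h0).1.2
      rw [pow_apply_eq_zero_of_isCritical hτ _ ρ' (Or.inl (by omega)), mul_zero]
  rw [e, hUU, zero_mul, add_zero, Matrix.add_apply, h0, zero_add, Matrix.mul_apply]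

theorem pow_two_mul_apply {τ : Finset (Fin q)} (hτ : IsCritical m τ) (k : ℕ)
    {ρ : Finset (Fin q)} (h : ρ.card = τ.card) :
    ((unprunedBoundary K m + reversal K m) ^ (2 * k)) ρ τ =
        ((reversal K m * unprunedBoundary K m) ^ k) ρ τ ∧
      ((unprunedBoundary K m + reversal K m) ^ (2 * k + 1)) ρ τ = 0 := by
  induction k generalizing ρ with
  | zero =>
    refine ⟨by simp, ?_⟩
    rw [mul_zero, zero_add, pow_one, Matrix.add_apply]
    have h1 : unprunedBoundary K m ρ τ = 0 := by
      by_contra h0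
      have := (unprunedBoundary_ne_zero h0).1.2
      omega
    have h2 : reversal K m ρ τ = 0 := by
      by_contra h0
      have := (reversal_ne_zero h0).isEdge.2
      omega
    rw [h1, h2, add_zero]
  | succ k ih =>
    have hcard : ∀ ρ', (reversal K m * unprunedBoundary K m) ρ ρ' ≠ 0 → ρ'.card = τ.card := by
      intro ρ' h'
      obtain ⟨μ, h1, h2, -⟩ := gradientStep_of_ne_zero h'
      have := h1.isEdge.2
      have := h2.2
      omega
    constructor
    · rw [mul_add, mul_one, pow_add_two_apply hτ _ h, pow_succ', Matrix.mul_apply]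
      refine Finset.sum_congr rfl fun ρ' _ => ?_
      by_cases h0 : (reversal K m * unprunedBoundary K m) ρ ρ' = 0
      · rw [h0, zero_mul, zero_mul]
      · rw [(ih (hcard ρ' h0)).1]
    · rw [mul_add, mul_one, add_right_comm, pow_add_two_apply hτ _ h]
      refine Finset.sum_eq_zero fun ρ' _ => ?_
      by_cases h0 : (reversal K m * unprunedBoundary K m) ρ ρ' = 0
      · rw [h0, zero_mul]
      · rw [(ih (hcard ρ' h0)).2, mul_zero]

theorem sum_range_eq_sum_range_half {M : Type*} [AddCommMonoid M] (a b : ℕ → M)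
    (h0 : ∀ k, a (2 * k) = b k) (h1 : ∀ k, a (2 * k + 1) = 0) (N : ℕ) :
    ∑ l ∈ Finset.range N, a l = ∑ k ∈ Finset.range ((N + 1) / 2), b k := by
  induction N with
  | zero => simp
  | succ N ih =>
    rw [Finset.sum_range_succ, ih]
    rcases Nat.even_or_odd' N with ⟨k, rfl | rfl⟩
    · rw [show (2 * k + 1 + 1) / 2 = k + 1 by omega, show (2 * k + 1) / 2 = k by omega,
        Finset.sum_range_succ, h0]
    · rw [show (2 * k + 1 + 1 + 1) / 2 = (2 * k + 1 + 1) / 2 by omega, h1, add_zero]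

theorem pathSum_eq_gradientFlow {ρ τ : Finset (Fin q)} (hτ : IsCritical m τ)
    (h : ρ.card = τ.card) : pathSum K m ρ τ = gradientFlow K m ρ τ := by
  classical
  rw [pathSum_eq, gradientFlow, Matrix.sum_apply,
    sum_range_eq_sum_range_half _ (fun k => ((reversal K m * unprunedBoundary K m) ^ k) ρ τ)
      (fun k => (pow_two_mul_apply hτ k h).1) (fun k => (pow_two_mul_apply hτ k h).2)]
  have hpos := Nat.two_pow_pos q
  -- Paths with fewer than `2 ^ q` edges cover only `k < (2 ^ q + 1) / 2` gradient steps. The other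
  -- terms vanish: since `τ` is critical, there are fewer than `2 ^ q / 2` lower cells.
  refine Finset.sum_subset (Finset.range_mono (by omega)) fun k _ hk => ?_
  by_contra hne
  have h1 := pow_apply_ne_zero_le m hne
  have h2 := two_mul_card_isLower_add_le m
  have h3 : 0 < (Finset.univ.filter (IsCritical m)).card :=
    Finset.card_pos.2 ⟨τ, by simpa using hτ⟩
  rw [Finset.mem_range] at hk
  omega

theorem morseCoeff_eq {σ τ : Finset (Fin q)} (hσ : IsCritical m σ) (hτ : IsCritical m τ)
    (h : σ.card = τ.card + 1) : morseCoeff K m σ τ = morseMatrix K m σ τ := by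
  classical
  rw [morseMatrix, mul_cellProj_apply, mul_assoc, cellProj_mul_apply, if_pos hτ, if_pos hσ,
    Matrix.mul_apply, morseCoeff, Finset.sum_filter]
  refine Finset.sum_congr (by congr!) fun ρ _ => ?_
  simp only [boundary, Matrix.of_apply]
  split_ifs with he
  · rw [pathSum_eq_gradientFlow hτ (by have := he.2; omega)]
  · have : incidence K σ ρ = 0 := by
      by_contra hne
      exact he (isEdge_of_incidence_ne_zero hne)
    rw [this, zero_mul]

end PathSum

/-! ### Exactness of the scalar complex in one multidegree. -/

section Strand

variable {K : Type*} [Field K] {q n : ℕ} {m : Fin q → (Fin n →₀ ℕ)}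

theorem morseMatrix_mul_self : morseMatrix K m * morseMatrix K m = 0 := by
  obtain ⟨p, -, hDp, -, hpCp, -, hM⟩ := exists_projection (K := K) m
  set C := cellProj K (IsCritical m)
  set D := boundary K q
  have e : C * D * p * C * (C * D * p * C) = C * D * (p * (C * C) * (D * p)) * C := by
    noncomm_ring
  have e2 : p * C * (p * D) = (p * C * p) * D := by noncomm_ring
  rw [← hM, e, cellProj_mul_self, hDp, e2, hpCp, ← hDp, ← mul_assoc, mul_assoc C D,
    boundary_mul_boundary]
  simp

/-- In a multidegree `b` in which `I` is not zero, the pruned complex is exact. -/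
theorem exists_vecMul_morseMatrix_eq {b : Fin n →₀ ℕ} {a : Fin q} (ha : m a ≤ b) {k : ℕ}
    {v : Finset (Fin q) → K} (hv : ∀ σ, v σ ≠ 0 → IsCritical m σ ∧ gr m σ ≤ b ∧ σ.card = k)
    (h : Matrix.vecMul v (morseMatrix K m) = 0) :
    ∃ u : Finset (Fin q) → K, (∀ σ, u σ ≠ 0 → IsCritical m σ ∧ gr m σ ≤ b ∧ σ.card = k + 1) ∧
      Matrix.vecMul u (morseMatrix K m) = v := by
  classical
  obtain ⟨p, hp, hDp, hpp, hpCp, hCpC, hM⟩ := exists_projection (K := K) m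
  set C := cellProj K (IsCritical m) with hC
  set D := boundary K q with hD
  have hvC : Matrix.vecMul v C = v := by
    ext σ
    rw [hC, cellProj, Matrix.vecMul_diagonal]
    by_cases hσ : v σ = 0
    · simp [hσ]
    · simp [(hv σ hσ).1]
  -- Every factor of `p` respects degrees, so `p` preserves the vectors supported in degrees at most
  -- `b`.
  have hpGr : Supported (GrLE m) p := by
    have hZ : Supported (GrLE m) (gradientFlow K m) := fun σ τ h =>
      (supported_gradientFlow m σ τ h).1
    have hDg : Supported (GrLE m) D := fun σ τ h => (supported_boundary σ τ h).gr_le m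
    have hU : Supported (GrLE m) (reversal K m) := fun σ τ h =>
      (supported_reversal m σ τ h).gr_eq.ge
    have ht : ∀ x y z, GrLE m x y → GrLE m y z → GrLE m x z := fun x y z h1 h2 => le_trans h2 h1
    rw [hp]
    exact ((Supported.one fun σ => le_refl (gr m σ)).add (hDg.mul (hZ.mul hU ht) ht)).add
      ((hZ.mul hU ht).mul hDg ht)
  have hdown : ∀ {A : Matrix (Finset (Fin q)) (Finset (Fin q)) K} {w : Finset (Fin q) → K},
      Supported (GrLE m) A → (∀ σ, w σ ≠ 0 → gr m σ ≤ b) →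
      ∀ σ, Matrix.vecMul w A σ ≠ 0 → gr m σ ≤ b := by
    intro A w hA hw σ hσ
    by_contra hn
    exact hσ (hA.vecMul_eq_zero hw σ fun x hx hr => hn (le_trans hr hx))
  have hwb : ∀ σ, Matrix.vecMul v p σ ≠ 0 → gr m σ ≤ b := hdown hpGr fun σ hσ => (hv σ hσ).2.1
  -- The Morse cycle `v` becomes a cycle of the simplex under `p`. There it bounds its cone over
  -- `a`, which stays in degrees at most `b` because `m a ≤ b`. Applying `p * C` to the cone returns
  -- to critical cells.
  have hwD : Matrix.vecMul (Matrix.vecMul v p) D = 0 := by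
    have e : C * D * p = morseMatrix K m * p := by
      rw [← hM]
      conv_lhs => rw [← hpCp]
      noncomm_ring
    calc Matrix.vecMul (Matrix.vecMul v p) D
        = Matrix.vecMul (Matrix.vecMul v C) (D * p) := by rw [hvC, hDp, Matrix.vecMul_vecMul]
      _ = Matrix.vecMul (Matrix.vecMul v (morseMatrix K m)) p := by
          rw [Matrix.vecMul_vecMul, Matrix.vecMul_vecMul, ← mul_assoc, e]
      _ = 0 := by rw [h, Matrix.zero_vecMul]
  have hwb' : ∀ σ, Matrix.vecMul (Matrix.vecMul v p) (cone K a) σ ≠ 0 → gr m σ ≤ b := by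
    intro σ hσ
    by_contra hn
    refine hσ (Supported.vecMul_eq_zero (r := fun σ τ => τ = insert a σ) ?_ hwb σ ?_)
    · intro x y hxy
      by_contra hne
      exact hxy (by simp [cone, hne])
    · rintro x hx rfl
      exact hn (by rw [gr, Finset.sup_insert]; exact sup_le ha hx)
  have hw : Matrix.vecMul (Matrix.vecMul (Matrix.vecMul v p) (cone K a)) D =
      Matrix.vecMul v p := by
    have := congrArg (Matrix.vecMul (Matrix.vecMul v p)) (boundary_mul_cone_add (K := K) a)
    rwa [Matrix.vecMul_add, ← Matrix.vecMul_vecMul, hwD, Matrix.zero_vecMul, zero_add,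
      ← Matrix.vecMul_vecMul, Matrix.vecMul_one] at this
  set u := Matrix.vecMul (Matrix.vecMul (Matrix.vecMul v p) (cone K a)) (p * C) with hu
  have huC : ∀ σ, u σ ≠ 0 → IsCritical m σ ∧ gr m σ ≤ b := by
    intro σ hσ
    rw [hu, ← Matrix.vecMul_vecMul, hC, cellProj, Matrix.vecMul_diagonal] at hσ
    refine ⟨?_, hdown hpGr hwb' σ (left_ne_zero_of_mul hσ)⟩
    by_contra hn
    exact right_ne_zero_of_mul hσ (if_neg hn)
  have huM : Matrix.vecMul u (morseMatrix K m) = v := by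
    have e : p * C * morseMatrix K m = D * (p * C) := by
      have e1 : p * C * (C * D * p * C) = p * (C * C) * (D * p) * C := by noncomm_ring
      have e2 : p * C * (p * D) * C = (p * C * p) * D * C := by noncomm_ring
      rw [← hM, e1, cellProj_mul_self, hDp, e2, hpCp, ← hDp, mul_assoc]
    have e3 : C * (p * (p * C)) = C := by rw [← mul_assoc p, hpp, ← mul_assoc, hCpC]
    rw [hu, Matrix.vecMul_vecMul, e, ← Matrix.vecMul_vecMul, hw]
    conv_lhs => rw [← hvC]
    rw [Matrix.vecMul_vecMul, Matrix.vecMul_vecMul, e3, hvC]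
  -- The Morse matrix lowers the cardinality by exactly one and `v` lives in cardinality `k`, so the
  -- components of `u` in other cardinalities can be dropped.
  refine ⟨fun σ => if σ.card = k + 1 then u σ else 0, ?_, ?_⟩
  · intro σ hσ
    by_cases hk : σ.card = k + 1
    · simp only [if_pos hk] at hσ
      exact ⟨(huC σ hσ).1, (huC σ hσ).2, hk⟩
    · exact absurd (if_neg hk) hσ
  · ext τ
    have hsupp := supported_morseMatrix (K := K) m
    by_cases hτ : τ.card = k
    · rw [← congrFun huM τ, Matrix.vecMul, Matrix.vecMul, dotProduct, dotProduct]
      refine Finset.sum_congr rfl fun σ _ => ?_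
      by_cases h0 : morseMatrix K m σ τ = 0
      · rw [h0, mul_zero, mul_zero]
      · rw [if_pos ((hsupp σ τ h0).2.2.2.trans (by rw [hτ]))]
    · have h1 : v τ = 0 := by
        by_contra hne
        exact hτ (hv τ hne).2.2
      rw [h1]
      refine hsupp.vecMul_eq_zero (p := fun σ => σ.card = k + 1) ?_ τ ?_
      · intro σ hσ
        by_contra hn
        exact hσ (if_neg hn)
      · rintro σ hσ ⟨-, -, -, hc⟩
        omega

end Strand

/-! ### From scalar strands to free modules over the polynomial ring. -/

section Transfer

variable {K : Type*} [Field K] {q n : ℕ} {m : Fin q → (Fin n →₀ ℕ)}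

open Classical in
/-- The component in multidegree `b` of an element of a module of the pruned complex. -/
noncomputable def strand (b : Fin n →₀ ℕ) {i : ℕ} (z : CriticalCell m i → MvPolynomial (Fin n) K) :
    Finset (Fin q) → K := fun σ =>
  if h : IsCritical m σ ∧ σ.card = i then
    if gr m σ ≤ b then coeff (b - gr m σ) (z ⟨σ, h⟩) else 0
  else 0

open Classical in
/-- The homogeneous element of multidegree `b` with given coefficients. -/
noncomputable def ofStrand (m : Fin q → (Fin n →₀ ℕ)) (b : Fin n →₀ ℕ) (i : ℕ)
    (v : Finset (Fin q) → K) : CriticalCell m i → MvPolynomial (Fin n) K := fun σ =>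
  if gr m σ.1 ≤ b then monomial (b - gr m σ.1) (v σ.1) else 0

theorem strand_apply (b : Fin n →₀ ℕ) {i : ℕ} (z : CriticalCell m i → MvPolynomial (Fin n) K)
    (σ : CriticalCell m i) (h : gr m σ.1 ≤ b) : strand b z σ.1 = coeff (b - gr m σ.1) (z σ) := by
  rw [strand, dif_pos σ.2, if_pos h]

theorem strand_ne_zero {b : Fin n →₀ ℕ} {i : ℕ} {z : CriticalCell m i → MvPolynomial (Fin n) K}
    {σ : Finset (Fin q)} (h : strand b z σ ≠ 0) : IsCritical m σ ∧ gr m σ ≤ b ∧ σ.card = i := by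
  rw [strand] at h
  split_ifs at h with h1 h2
  · exact ⟨h1.1, h2, h1.2⟩
  · exact absurd rfl h
  · exact absurd rfl h

theorem strand_sum {ι : Type*} (b : Fin n →₀ ℕ) {i : ℕ} (s : Finset ι)
    (z : ι → CriticalCell m i → MvPolynomial (Fin n) K) :
    strand b (∑ j ∈ s, z j) = ∑ j ∈ s, strand b (z j) := by
  ext σ
  rw [Finset.sum_apply]
  simp only [strand]
  split_ifs
  · rw [Finset.sum_apply, coeff_sum]
  · simp
  · simp

theorem ext_strand {i : ℕ} {z z' : CriticalCell m i → MvPolynomial (Fin n) K}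
    (h : ∀ b, strand b z = strand b z') : z = z' := by
  ext σ c
  have hle : gr m σ.1 ≤ c + gr m σ.1 := le_add_self
  have := congrFun (h (c + gr m σ.1)) σ.1
  rwa [strand_apply _ _ _ hle, strand_apply _ _ _ hle, add_tsub_cancel_right] at this

theorem strand_ofStrand {b b' : Fin n →₀ ℕ} {i : ℕ} {v : Finset (Fin q) → K}
    (hv : ∀ σ, v σ ≠ 0 → IsCritical m σ ∧ gr m σ ≤ b ∧ σ.card = i) :
    strand b' (ofStrand m b i v) = if b' = b then v else 0 := by
  classical
  ext σ
  by_cases hσ : IsCritical m σ ∧ σ.card = i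
  · by_cases hb' : gr m σ ≤ b'
    · rw [strand_apply b' _ ⟨σ, hσ⟩ hb', ofStrand]
      by_cases hb : gr m σ ≤ b
      · rw [if_pos hb, coeff_monomial]
        by_cases h : b' = b
        · simp [h]
        · have : b - gr m σ ≠ b' - gr m σ := fun he => h (by
            rw [← tsub_add_cancel_of_le hb', ← tsub_add_cancel_of_le hb, he])
          simp [h, this]
      · have : v σ = 0 := by
          by_contra hne
          exact hb (hv σ hne).2.1
        rw [if_neg hb]
        split_ifs <;> simp [this]
    · have h0 : strand b' (ofStrand m b i v) σ = 0 := by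
        by_contra hne
        exact hb' (strand_ne_zero hne).2.1
      rw [h0]
      split_ifs with h
      · by_contra hne
        exact hb' (h ▸ (hv σ (Ne.symm hne)).2.1)
      · rfl
  · have h0 : strand b' (ofStrand m b i v) σ = 0 := by
      by_contra hne
      exact hσ ⟨(strand_ne_zero hne).1, (strand_ne_zero hne).2.2⟩
    have h1 : v σ = 0 := by
      by_contra hne
      exact hσ ⟨(hv σ hne).1, (hv σ hne).2.2⟩
    rw [h0]
    split_ifs <;> simp [h1]

theorem diffMatrix_apply {i : ℕ} (τ : CriticalCell m i) (σ : CriticalCell m (i + 1)) :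
    diffMatrix K m i τ σ = monomial (gr m σ.1 - gr m τ.1) (morseMatrix K m σ.1 τ.1) := by
  rw [diffMatrix, morseCoeff_eq σ.2.1 τ.2.1 (by rw [σ.2.2, τ.2.2])]

/-- The monomial factors of the differential exactly compensate the shifts by `gr`, so exactness
becomes linear algebra over `K` in each multidegree. -/
theorem strand_diff (b : Fin n →₀ ℕ) {i : ℕ}
    (z : CriticalCell m (i + 1) → MvPolynomial (Fin n) K) :
    strand b (diff K m i z) = Matrix.vecMul (strand b z) (morseMatrix K m) := by
  classical
  have hsupp := supported_morseMatrix (K := K) m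
  ext τ
  by_cases hτ : (IsCritical m τ ∧ τ.card = i) ∧ gr m τ ≤ b
  · obtain ⟨hτ, hb⟩ := hτ
    rw [strand_apply b _ ⟨τ, hτ⟩ hb, diff, Matrix.mulVecLin_apply, Matrix.mulVec, dotProduct,
      coeff_sum, Matrix.vecMul, dotProduct]
    refine Fintype.sum_of_injective Subtype.val Subtype.val_injective _ _ ?_ ?_
    · intro σ hσ
      have : strand b z σ = 0 := by
        by_contra hne
        have := strand_ne_zero hne
        exact hσ ⟨⟨σ, this.1, this.2.2⟩, rfl⟩
      rw [this, zero_mul]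
    · intro σ
      rw [diffMatrix_apply]
      by_cases h0 : morseMatrix K m σ.1 τ = 0
      · simp [h0]
      · have hle : gr m τ ≤ gr m σ.1 := (hsupp _ _ h0).2.2.1
        rw [coeff_monomial_mul']
        by_cases hσb : gr m σ.1 ≤ b
        · rw [if_pos (tsub_le_tsub_right hσb _), strand_apply b z σ hσb, mul_comm,
            tsub_tsub_tsub_cancel_right hle]
        · rw [if_neg, strand, dif_pos σ.2, if_neg hσb, zero_mul]
          intro h
          exact hσb ((tsub_le_tsub_iff_right hb).1 h)
  · have h0 : strand b (diff K m i z) τ = 0 := by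
      by_contra hne
      have := strand_ne_zero hne
      exact hτ ⟨⟨this.1, this.2.2⟩, this.2.1⟩
    rw [h0]
    refine (hsupp.vecMul_eq_zero (fun σ hσ => strand_ne_zero hσ) τ ?_).symm
    rintro σ ⟨-, h1, h2⟩ ⟨-, h3, h4, h5⟩
    exact hτ ⟨⟨h3, by omega⟩, le_trans h4 h1⟩

theorem strand_zero (b : Fin n →₀ ℕ) {i : ℕ} :
    strand b (0 : CriticalCell m i → MvPolynomial (Fin n) K) = 0 := by
  ext σ
  simp [strand]

theorem exists_diff_eq {i : ℕ} (z : CriticalCell m i → MvPolynomial (Fin n) K)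
    (h : ∀ b, ∃ u : Finset (Fin q) → K,
      (∀ σ, u σ ≠ 0 → IsCritical m σ ∧ gr m σ ≤ b ∧ σ.card = i + 1) ∧
      Matrix.vecMul u (morseMatrix K m) = strand b z) : ∃ y, diff K m i y = z := by
  classical
  choose u hu huz using h
  -- The finitely many multidegrees in which `z` has a component; the preimages found there are
  -- summed.
  set B : Finset (Fin n →₀ ℕ) := Finset.univ.biUnion fun σ : CriticalCell m i =>
    (z σ).support.image fun c => c + gr m σ.1 with hB
  have hBz : ∀ b ∉ B, strand b z = 0 := by
    intro b hb
    ext σ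
    by_contra hne
    obtain ⟨h1, h2, h3⟩ := strand_ne_zero hne
    rw [strand_apply b z ⟨σ, h1, h3⟩ h2] at hne
    refine hb (Finset.mem_biUnion.2 ⟨⟨σ, h1, h3⟩, Finset.mem_univ _, Finset.mem_image.2
      ⟨b - gr m σ, mem_support_iff.2 hne, tsub_add_cancel_of_le h2⟩⟩)
  refine ⟨∑ b ∈ B, ofStrand m b (i + 1) (u b), ext_strand fun b => ?_⟩
  rw [strand_diff, strand_sum]
  simp_rw [strand_ofStrand (hu _)]
  rw [Finset.sum_ite_eq]
  split_ifs with hb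
  · exact huz b
  · rw [hBz b hb, Matrix.zero_vecMul]

theorem isCritical_empty (h : ∀ j, m j ≠ 0) : IsCritical m ∅ := by
  intro τ
  constructor
  · rintro ⟨j, rfl, h'⟩
    refine h j ?_
    have := h'.2.2.2
    rwa [gr, gr, Finset.sup_empty, insert_empty_eq, Finset.sup_singleton, eq_comm] at this
  · rintro ⟨j, h', -⟩
    exact Finset.insert_ne_empty _ _ h'.symm

/-- The pruned complex is a resolution, whatever the order of the generators. -/
theorem isResolution {I : Ideal (MvPolynomial (Fin n) K)}
    (hmem : ∀ i, monomial (m i) (1 : K) ∈ I)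
    (hdvd : ∀ x ∈ I, ∀ b ∈ x.support, ∃ i, m i ≤ b) : IsResolution I m where
  surjective := by
    intro x
    by_cases hI : I = ⊤
    · subst hI
      exact ⟨0, Subsingleton.elim _ _⟩
    · obtain ⟨r, rfl⟩ := Submodule.mkQ_surjective I x
      have hc : IsCritical m ∅ := isCritical_empty fun j hj => hI <| by
        rw [Ideal.eq_top_iff_one]
        have := hmem j
        rwa [hj] at this
      refine ⟨fun _ => r, ?_⟩
      have hu : (Finset.univ : Finset (CriticalCell m 0)) = {⟨∅, hc, Finset.card_empty⟩} := by
        ext σ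
        simp only [Finset.mem_univ, Finset.mem_singleton, true_iff]
        exact Subtype.ext (Finset.card_eq_zero.1 σ.2.2)
      rw [augmentation, LinearMap.comp_apply, LinearMap.sum_apply, hu, Finset.sum_singleton]
      rfl
  exact_zero := by
    intro z
    have haug : augmentation I m z = 0 ↔ ∑ σ, z σ ∈ I := by
      rw [augmentation, LinearMap.comp_apply, LinearMap.sum_apply]
      simp only [LinearMap.proj_apply]
      exact Submodule.Quotient.mk_eq_zero I
    rw [haug]
    constructor
    · intro hz
      refine exists_diff_eq z fun b => ?_
      by_cases hb : ∃ a, m a ≤ b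
      · obtain ⟨a, ha⟩ := hb
        refine exists_vecMul_morseMatrix_eq ha (fun σ hσ => strand_ne_zero hσ) ?_
        ext τ
        refine (supported_morseMatrix m).vecMul_eq_zero (fun σ hσ => strand_ne_zero hσ) τ ?_
        rintro σ ⟨-, -, h1⟩ ⟨-, -, -, h2⟩
        omega
      -- No generator divides `b`, whereas a nonzero component would give a monomial dividing `b` in
      -- the support of an element of `I`.
      · have h0 : strand b z = 0 := by
          ext σ
          by_contra hne
          obtain ⟨h1, h2, h3⟩ := strand_ne_zero hne
          rw [strand_apply b z ⟨σ, h1, h3⟩ h2] at hne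
          have hu : (Finset.univ : Finset (CriticalCell m 0)) = {⟨σ, h1, h3⟩} := by
            ext τ
            simp only [Finset.mem_univ, Finset.mem_singleton, true_iff]
            exact Subtype.ext ((Finset.card_eq_zero.1 τ.2.2).trans (Finset.card_eq_zero.1 h3).symm)
          rw [hu, Finset.sum_singleton] at hz
          obtain ⟨i, hi⟩ := hdvd _ hz _ (mem_support_iff.2 hne)
          exact hb ⟨i, hi.trans tsub_le_self⟩
        exact ⟨0, fun σ h => absurd rfl h, by rw [h0, Matrix.zero_vecMul]⟩
    · rintro ⟨y, rfl⟩
      refine Ideal.sum_mem _ fun τ _ => ?_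
      rw [diff, Matrix.mulVecLin_apply, Matrix.mulVec, dotProduct]
      refine Ideal.sum_mem _ fun σ _ => Ideal.mul_mem_right _ _ ?_
      obtain ⟨j, hj⟩ := Finset.card_eq_one.1 σ.2.2
      have hτ : gr m τ.1 = 0 := by rw [Finset.card_eq_zero.1 τ.2.2]; rfl
      rw [diffMatrix, hj, hτ, tsub_zero, gr, Finset.sup_singleton, ← mul_one (morseCoeff K m _ _),
        ← C_mul_monomial]
      exact Ideal.mul_mem_left _ _ (hmem j)
  exact_succ := by
    intro i z
    constructor
    · intro hz
      refine exists_diff_eq z fun b => ?_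
      by_cases hb : ∃ a, m a ≤ b
      · obtain ⟨a, ha⟩ := hb
        refine exists_vecMul_morseMatrix_eq ha (fun σ hσ => strand_ne_zero hσ) ?_
        rw [← strand_diff, hz, strand_zero]
      -- Cells of size `i + 1` are nonempty, and any vertex of a cell of degree at most `b` would be
      -- a generator dividing `b`.
      · have h0 : strand b z = 0 := by
          ext σ
          by_contra hne
          obtain ⟨h1, h2, h3⟩ := strand_ne_zero hne
          obtain ⟨a, ha⟩ := Finset.card_pos.1 (show 0 < σ.card by omega)
          exact hb ⟨a, le_trans (Finset.le_sup ha) h2⟩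
        exact ⟨0, fun σ h => absurd rfl h, by rw [h0, Matrix.zero_vecMul]⟩
    · rintro ⟨y, rfl⟩
      refine ext_strand fun b => ?_
      rw [strand_diff, strand_diff, Matrix.vecMul_vecMul, morseMatrix_mul_self,
        Matrix.vecMul_zero, strand_zero]
  homogeneous := by
    intro i τ σ h
    rw [diffMatrix_apply] at h
    exact (supported_morseMatrix m _ _ fun h0 => h (by rw [h0, monomial_zero])).2.2.1

/-- A unit has nonzero constant term, so the truncated difference of degrees is `0`, that is `gr σ ≤
gr τ`; a nonzero coefficient gives the reverse inequality. -/
theorem isMinimal_of_morseMatrix_eq_zero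
    (h : ∀ σ τ, gr m σ = gr m τ → morseMatrix K m σ τ = 0) : IsMinimal K m := by
  intro i τ σ hu
  rw [diffMatrix_apply] at hu
  have h0 : morseMatrix K m σ.1 τ.1 ≠ 0 := by
    intro h0
    rw [h0, monomial_zero] at hu
    exact hu.ne_zero rfl
  have hc := (hu.map (constantCoeff (R := K) (σ := Fin n))).ne_zero
  rw [constantCoeff_monomial] at hc
  have he : gr m σ.1 - gr m τ.1 = 0 := by
    by_contra hne
    exact hc (if_neg hne)
  exact h0 (h _ _ (le_antisymm (tsub_eq_zero_iff_le.1 he) (supported_morseMatrix m _ _ h0).2.2.1))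

end Transfer

/-! ### Divisibility by minimal generators. -/

section Generators

variable {K : Type*} [Field K] {n : ℕ}

theorem IsSquarefreeMonomialIdeal.exists_minimalGenerator_le
    {I : Ideal (MvPolynomial (Fin n) K)} (hI : IsSquarefreeMonomialIdeal I)
    {x : MvPolynomial (Fin n) K} (hx : x ∈ I) {b : Fin n →₀ ℕ} (hb : b ∈ x.support) :
    ∃ a ∈ minimalGenerators I, a ≤ b := by
  obtain ⟨S, -, rfl⟩ := hI
  obtain ⟨s, hs, hsb⟩ := mem_ideal_span_monomial_image.1 hx b hb
  obtain ⟨a, ha, hmin⟩ := exists_minimal_le_of_wellFoundedLT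
    (fun c => monomial c (1 : K) ∈ Ideal.span ((fun a => monomial a (1 : K)) '' S)) s
    (Ideal.subset_span ⟨s, hs, rfl⟩)
  exact ⟨a, hmin, ha.trans hsb⟩

end Generators

/-! A family of subsets of `{0, …, 4}` is encoded by a natural number: the set `s` belongs to the
family if the binary digit at the position `∑ i ∈ s, 2 ^ i` is `1`. -/

/-! ### Bit-mask test for gradient paths, and its evaluation on all upper sets. -/

section Masks

/-- The family of all subsets of `{0, …, 4}` that do not contain `k`. -/
def lowMask : ℕ → ℕ
  | 0 => 0x55555555
  | 1 => 0x33333333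
  | 2 => 0x0f0f0f0f
  | 3 => 0x00ff00ff
  | _ => 0x0000ffff

/-- Evaluate `x` before applying `f`. -/
noncomputable def force {α : Type} (x : ℕ) (f : ℕ → α) : α :=
  Nat.rec (f 0) (fun y _ => f (Nat.succ y)) x

/-- Mathematically `force` is plain application. Its recursor only makes the kernel reduce `x` to a
numeral before substituting it. -/
theorem force_eq {α : Type} (x : ℕ) (f : ℕ → α) : force x f = f x := by
  cases x <;> rfl

/-- The lower ends of the edges that are pruned in direction `k` if the family `X` is alive. -/
def matched (X k : ℕ) : ℕ := Nat.land (Nat.land X (Nat.shiftRight X (Nat.pow 2 k))) (lowMask k)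

/-- The family that remains after pruning the edges with lower ends `t` in direction `k`. -/
def pruneStep (X k t : ℕ) : ℕ := Nat.xor X (Nat.lor t (Nat.shiftLeft t (Nat.pow 2 k)))

/-- The family that remains after pruning in the directions of the list. -/
noncomputable def remaining (L : List ℕ) : ℕ → ℕ :=
  List.rec (fun X => X)
    (fun k _ ih X => force (matched X k) fun t => force (pruneStep X k t) ih) L

/-- The upper ends of the pruned edges whose lower ends are in `S`. -/
noncomputable def flowUp (S : ℕ) (L : List ℕ) : ℕ → ℕ :=
  List.rec (fun _ => 0) (fun k _ ih X => force (matched X k) fun t =>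
    Nat.lor (Nat.shiftLeft (Nat.land S t) (Nat.pow 2 k)) (force (pruneStep X k t) ih)) L

/-- The facets of the members of `T`. -/
noncomputable def facets (T : ℕ) (L : List ℕ) : ℕ :=
  List.rec 0 (fun k _ ih => Nat.lor (Nat.land (Nat.shiftRight T (Nat.pow 2 k)) (lowMask k)) ih) L

/-- The cells of `X` that are reached from the critical cells, or by one gradient step from `S`. -/
noncomputable def reachStep (L : List ℕ) (X C S : ℕ) : ℕ :=
  force (Nat.lor C (flowUp S L X)) fun T => Nat.land (facets T L) X

/-- Search for a family closed under `reachStep` that contains no critical cell. -/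
noncomputable def searchClosed (L : List ℕ) (X C fuel : ℕ) : ℕ → Bool :=
  Nat.rec (fun _ => false) (fun _ ih S => force (reachStep L X C S) fun T =>
    bif Nat.beq (Nat.land T S) T then Nat.beq (Nat.land S C) 0 else force (Nat.lor S T) ih) fuel

/-- No gradient path joins two critical cells. -/
noncomputable def isGood (L : List ℕ) (X : ℕ) : Bool :=
  force (remaining L X) fun C => searchClosed L X C 8 0

/-- Check a condition for all upper sets of subsets of `{0, …, k - 1}` that contain the family
`l`. -/
noncomputable def forallUpset (k : ℕ) : ℕ → (ℕ → Bool) → Bool :=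
  Nat.rec (fun l f => (!(Nat.beq l 0) || f 0) && f 1)
    (fun k ih l f => force (Nat.mod l (Nat.pow 2 (Nat.pow 2 k))) fun l₀ =>
      force (Nat.shiftRight l (Nat.pow 2 k)) fun l₁ =>
        ih l₀ fun a => force (Nat.lor l₁ a) fun l₂ =>
          ih l₂ fun b => force (Nat.lor a (Nat.shiftLeft b (Nat.pow 2 k))) f) k

theorem isGood_range_of_le_three : ((List.range 4).all fun N =>
    forallUpset N 0 (isGood (List.range N))) = true := by
  decide +kernel

/-- Here `26752 = 2 ^ 7 + 2 ^ 11 + 2 ^ 13 + 2 ^ 14`, where `7, 11, 13, 14` code the four triples in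
`{0, 1, 2, 3}`. -/
theorem isGood_range_four : forallUpset 4 0 (fun X => Nat.beq (Nat.land X 26752) 26752 ||
    isGood [0, 1, 2, 3] X) = true := by
  decide +kernel

/-- At least two of three conditions hold. -/
def majority (a b c : Bool) : Bool := a && b || a && c || b && c

/-- Two good orders out of three, rather than one, let the choice be matched with a second fiber. -/
theorem majority_isGood_four : forallUpset 4 0 (fun X => majority (isGood [0, 1, 2, 3] X)
    (isGood [1, 2, 0, 3] X) (isGood [2, 0, 1, 3] X)) = true := by
  decide +kernel

/-- Shifting by `16 = 2 ^ 4` adds the element `4` to every member. These are the full fibers that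
occur next to a hollow fiber. -/
theorem majority_isGood_cone : forallUpset 4 0 (fun X => force (Nat.shiftLeft X 16) fun X =>
    majority (isGood [0, 1, 2, 3, 4] X) (isGood [1, 2, 0, 3, 4] X)
      (isGood [2, 0, 1, 3, 4] X)) = true := by
  decide +kernel

/-- The enumeration runs over all 7581 upper sets of subsets of a five-element set. -/
theorem isGood_five : forallUpset 5 0 (fun X => isGood [0, 1, 2, 3, 4] X ||
    isGood [1, 2, 0, 3, 4] X || isGood [3, 4, 0, 1, 2] X) = true := by
  decide +kernel

end Masks

/-! ### A closed family without critical cells forces the entry to vanish. -/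

section Vanishing

variable {K : Type*} [Field K] {q n : ℕ} {m : Fin q → (Fin n →₀ ℕ)}

/-- If no gradient path inside a fiber of `gr` joins critical cells, then the differential has no
invertible entry in this multidegree. -/
theorem morseMatrix_eq_zero_of_closed {b : Fin n →₀ ℕ} (T : Set (Finset (Fin q)))
    (h₁ : ∀ σ ρ, IsCritical m σ → gr m σ = b → IsEdge σ ρ → gr m ρ = b → ρ ∈ T)
    (h₂ : ∀ ρ ρ', ρ ∈ T → gr m ρ = b → GradientStep m ρ ρ' → gr m ρ' = b → ρ' ∈ T)
    (h₃ : ∀ τ ∈ T, gr m τ = b → ¬ IsCritical m τ) {σ τ : Finset (Fin q)} (hσ : gr m σ = b)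
    (hτ : gr m τ = b) : morseMatrix K m σ τ = 0 := by
  classical
  by_contra hne
  obtain ⟨hσc, hτc, -, -⟩ := supported_morseMatrix m σ τ hne
  rw [morseMatrix, mul_cellProj_apply, mul_assoc, cellProj_mul_apply, if_pos hτc, if_pos hσc,
    Matrix.mul_apply] at hne
  obtain ⟨ρ, -, hρ⟩ := Finset.exists_ne_zero_of_sum_ne_zero hne
  have he := supported_boundary _ _ (left_ne_zero_of_mul hρ)
  have hz := right_ne_zero_of_mul hρ
  have hg := (supported_gradientFlow m ρ τ hz).1
  rw [gradientFlow, Matrix.sum_apply] at hz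
  obtain ⟨k, -, hk⟩ := Finset.exists_ne_zero_of_sum_ne_zero hz
  -- Degrees only decrease along a path, and both ends have degree `b`, so the whole path stays in
  -- the fiber.
  have hρb : gr m ρ = b := le_antisymm ((he.gr_le m).trans_eq hσ) (hτ ▸ hg)
  have hρT := h₁ σ ρ hσc hσ he hρb
  clear hne hρ he hz hg
  refine h₃ τ ?_ hτ hτc
  induction k generalizing ρ with
  | zero =>
    rw [pow_zero, Matrix.one_apply] at hk
    by_cases h : ρ = τ
    · exact h ▸ hρT
    · exact absurd (if_neg h) hk
  | succ k ih =>
    rw [pow_succ', Matrix.mul_apply] at hk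
    obtain ⟨ρ', -, hρ'⟩ := Finset.exists_ne_zero_of_sum_ne_zero hk
    have hs := gradientStep_of_ne_zero (left_ne_zero_of_mul hρ')
    have hp := right_ne_zero_of_mul hρ'
    have hle : gr m τ ≤ gr m ρ' := Supported.pow (r := GrLE m)
      (fun x y h => (gradientStep_of_ne_zero h).gr_le) (fun x => le_refl (gr m x))
      (fun x y z h1 h2 => le_trans h2 h1) k ρ' τ hp
    have hb : gr m ρ' = b := le_antisymm (hs.gr_le.trans_eq hρb) (hτ ▸ hle)
    exact ih ρ' hp hb (h₂ ρ ρ' hρT hρb hs hb)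

theorem isCritical_iff_mem_survivors {σ : Finset (Fin q)} :
    IsCritical m σ ↔ σ ∈ survivors m q := by
  constructor
  · intro h
    suffices ∀ k, σ ∈ survivors m k from this q
    intro k
    induction k with
    | zero => trivial
    | succ k ih =>
      refine ⟨ih, ?_⟩
      rintro j rfl ρ hρ
      constructor
      · rintro rfl
        exact (h (insert j σ)).1 ⟨j, rfl, hρ⟩
      · rintro rfl
        exact (h ρ).2 ⟨j, rfl, hρ⟩
  · intro h τ
    constructor
    · rintro ⟨j, rfl, hj⟩
      exact hj.not_mem_survivors.1 (survivors_antitone m j.2 h)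
    · rintro ⟨j, rfl, hj⟩
      exact hj.not_mem_survivors.2 (survivors_antitone m j.2 h)

end Vanishing

/-! ### Unfolding the mask operations. -/

section MaskLemmas

theorem remaining_cons (k : ℕ) (L : List ℕ) (X : ℕ) :
    remaining (k :: L) X = remaining L (pruneStep X k (matched X k)) := by
  change force (matched X k) (fun t => force (pruneStep X k t) (remaining L)) = _
  simp only [force_eq]

theorem flowUp_cons (S k : ℕ) (L : List ℕ) (X : ℕ) : flowUp S (k :: L) X =
    (S &&& matched X k) <<< 2 ^ k ||| flowUp S L (pruneStep X k (matched X k)) := by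
  change force (matched X k) (fun t => Nat.lor (Nat.shiftLeft (Nat.land S t) (Nat.pow 2 k))
    (force (pruneStep X k t) (flowUp S L))) = _
  simp only [force_eq]
  rfl

theorem facets_cons (T k : ℕ) (L : List ℕ) :
    facets T (k :: L) = (T >>> 2 ^ k &&& lowMask k) ||| facets T L := rfl

theorem matched_eq (X k : ℕ) : matched X k = X &&& X >>> 2 ^ k &&& lowMask k := rfl

theorem pruneStep_eq (X k t : ℕ) : pruneStep X k t = X ^^^ (t ||| t <<< 2 ^ k) := rfl

theorem reachStep_eq (L : List ℕ) (X C S : ℕ) :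
    reachStep L X C S = facets (C ||| flowUp S L X) L &&& X := by
  rw [reachStep, force_eq]
  rfl

/-- Exhausted fuel returns `false`, so a positive answer always comes with a closed family and no
bound on the number of rounds is needed. -/
theorem exists_closed_of_searchClosed {L : List ℕ} {X C fuel S : ℕ}
    (h : searchClosed L X C fuel S = true) :
    ∃ S, reachStep L X C S &&& S = reachStep L X C S ∧ S &&& C = 0 := by
  induction fuel generalizing S with
  | zero => exact absurd h Bool.false_ne_true
  | succ fuel ih =>
    change force (reachStep L X C S) (fun T => bif Nat.beq (Nat.land T S) T then
      Nat.beq (Nat.land S C) 0 else force (Nat.lor S T) (searchClosed L X C fuel)) = true at h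
    rw [force_eq] at h
    cases hb : Nat.beq (Nat.land (reachStep L X C S) S) (reachStep L X C S) with
    | true =>
      rw [hb] at h
      exact ⟨S, Nat.eq_of_beq_eq_true hb, Nat.eq_of_beq_eq_true h⟩
    | false =>
      rw [hb, cond_false, force_eq] at h
      exact ih h

theorem exists_closed_of_isGood {L : List ℕ} {X : ℕ} (h : isGood L X = true) :
    ∃ S, reachStep L X (remaining L X) S &&& S = reachStep L X (remaining L X) S ∧
      S &&& remaining L X = 0 := by
  rw [isGood, force_eq] at h
  exact exists_closed_of_searchClosed h

theorem testBit_lowMask {k c : ℕ} (hk : k < 5) (hc : c < 32) :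
    (lowMask k).testBit c = !c.testBit k := by
  have h : ∀ k < 5, ∀ c < 32, (lowMask k).testBit c = !c.testBit k := by decide +kernel
  exact h k hk c hc

theorem testBit_of_testBit_lowMask {k c : ℕ} (hk : k < 5) (h : (lowMask k).testBit c = true) :
    c.testBit k = false := by
  rcases lt_or_ge c 32 with hc | hc
  · rw [testBit_lowMask hk hc] at h
    simpa using h
  · have h1 : lowMask k < 2 ^ 32 := by
      interval_cases k <;> decide
    rw [Nat.testBit_lt_two_pow (h1.trans_le (Nat.pow_le_pow_right (by norm_num) hc))] at h
    exact absurd h Bool.false_ne_true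

end MaskLemmas

/-! ### Soundness: the mask operations follow the pruning inside a fiber. -/

section Encoding

variable {q n : ℕ} (m : Fin q → (Fin n →₀ ℕ)) (b : Fin n →₀ ℕ) (w : Fin q → ℕ)

/-- The generators that divide the monomial with exponent `b`. -/
noncomputable def divisors : Finset (Fin q) := Finset.univ.filter fun i => m i ≤ b

/-- The position of the digit that belongs to a cell. -/
def code (σ : Finset (Fin q)) : ℕ := ∑ i ∈ σ.image w, 2 ^ i

/-- The number `X` encodes the family of the cells that satisfy `p`. -/
def Encodes (X : ℕ) (p : Finset (Fin q) → Prop) : Prop :=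
  ∀ σ ⊆ divisors m b, X.testBit (code w σ) = true ↔ p σ

/-- The directions in which the pruning algorithm proceeds from step `k` on. -/
noncomputable def directions (k : ℕ) : List ℕ :=
  (((List.finRange q).drop k).filter (· ∈ divisors m b)).map w

variable {m b w}

theorem mem_divisors {i : Fin q} : i ∈ divisors m b ↔ m i ≤ b := by
  simp [divisors]

theorem subset_divisors_iff {σ : Finset (Fin q)} : σ ⊆ divisors m b ↔ gr m σ ≤ b := by
  rw [gr, Finset.sup_le_iff]
  exact forall₂_congr fun i _ => mem_divisors

theorem testBit_code (σ : Finset (Fin q)) (k : ℕ) :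
    (code w σ).testBit k = true ↔ k ∈ σ.image w := by
  rw [← Nat.mem_bitIndices, ← List.mem_toFinset, code, Finset.toFinset_bitIndices_sum_two_pow]

theorem testBit_code_apply (hw : Set.InjOn w (divisors m b)) {σ : Finset (Fin q)}
    (hσ : σ ⊆ divisors m b) {j : Fin q} (hj : j ∈ divisors m b) :
    (code w σ).testBit (w j) = true ↔ j ∈ σ := by
  rw [testBit_code, Finset.mem_image]
  constructor
  · rintro ⟨i, hi, h⟩
    exact hw (hσ hi) hj h ▸ hi
  · exact fun h => ⟨j, h, rfl⟩

theorem code_insert (hw : Set.InjOn w (divisors m b)) {σ : Finset (Fin q)}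
    (hσ : σ ⊆ divisors m b) {j : Fin q} (hj : j ∈ divisors m b) (hjσ : j ∉ σ) :
    code w (insert j σ) = 2 ^ w j + code w σ := by
  rw [code, Finset.image_insert, Finset.sum_insert, code]
  rwa [← testBit_code, testBit_code_apply hw hσ hj]

theorem code_lt {N : ℕ} (hN : ∀ i ∈ divisors m b, w i < N) {σ : Finset (Fin q)}
    (hσ : σ ⊆ divisors m b) : code w σ < 2 ^ N := by
  refine Nat.lt_pow_two_of_testBit _ fun i hi => ?_
  rw [Bool.eq_false_iff, Ne, testBit_code, Finset.mem_image]
  rintro ⟨j, hj, rfl⟩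
  exact absurd (hN j (hσ hj)) (not_lt.2 hi)

theorem testBit_lowMask_code (hw : Set.InjOn w (divisors m b))
    (hw5 : ∀ i ∈ divisors m b, w i < 5) {σ : Finset (Fin q)} (hσ : σ ⊆ divisors m b)
    {j : Fin q} (hj : j ∈ divisors m b) :
    (lowMask (w j)).testBit (code w σ) = true ↔ j ∉ σ := by
  rw [testBit_lowMask (hw5 j hj) (code_lt hw5 hσ), Bool.not_eq_true', Bool.eq_false_iff, Ne,
    testBit_code_apply hw hσ hj]

/-- Inserting `j` adds `2 ^ w j` to the code of a cell, so shifting the mask right by that amount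
tests whether the enlarged cell belongs to the family. -/
theorem Encodes.matched (hw : Set.InjOn w (divisors m b)) (hw5 : ∀ i ∈ divisors m b, w i < 5)
    {X : ℕ} {A : Set (Finset (Fin q))} (hX : Encodes m b w X fun σ => gr m σ = b ∧ σ ∈ A)
    {j : Fin q} (hj : j ∈ divisors m b) :
    Encodes m b w (matched X (w j)) fun σ => gr m σ = b ∧ PrunedIn m A j σ := by
  intro σ hσ
  rw [matched_eq, Nat.testBit_and, Nat.testBit_and, Nat.testBit_shiftRight, Bool.and_eq_true,
    Bool.and_eq_true, testBit_lowMask_code hw hw5 hσ hj, hX σ hσ]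
  by_cases hjσ : j ∈ σ
  · simp [hjσ, PrunedIn]
  · rw [← code_insert hw hσ hj hjσ, hX _ (Finset.insert_subset hj hσ)]
    constructor
    · rintro ⟨⟨⟨h1, h2⟩, h3, h4⟩, -⟩
      exact ⟨h1, hjσ, h2, h4, h1.trans h3.symm⟩
    · rintro ⟨h1, -, h2, h3, h4⟩
      exact ⟨⟨⟨h1, h2⟩, h4 ▸ h1, h3⟩, hjσ⟩

theorem Encodes.pruneStep (hw : Set.InjOn w (divisors m b)) (hw5 : ∀ i ∈ divisors m b, w i < 5)
    {X : ℕ} {A : Set (Finset (Fin q))} (hX : Encodes m b w X fun σ => gr m σ = b ∧ σ ∈ A)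
    {j : Fin q} (hj : j ∈ divisors m b) :
    Encodes m b w (pruneStep X (w j) (Pruned.matched X (w j))) fun ρ => gr m ρ = b ∧ ρ ∈ A ∧
      ∀ σ, PrunedIn m A j σ → ρ ≠ σ ∧ ρ ≠ insert j σ := by
  intro σ hσ
  have ht := hX.matched hw hw5 hj
  rw [pruneStep_eq, Nat.testBit_xor, Nat.testBit_or, Nat.testBit_shiftLeft]
  by_cases hjσ : j ∈ σ
  · have hσ' : σ.erase j ⊆ divisors m b := (Finset.erase_subset _ _).trans hσ
    have hc : code w σ = 2 ^ w j + code w (σ.erase j) := by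
      rw [← code_insert hw hσ' hj (Finset.notMem_erase _ _), Finset.insert_erase hjσ]
    have h1 : (Pruned.matched X (w j)).testBit (code w σ) = false := by
      rw [Bool.eq_false_iff, Ne, ht σ hσ]
      exact fun h => h.2.1 hjσ
    have h2 : code w σ - 2 ^ w j = code w (σ.erase j) := by omega
    rw [h1, h2, Bool.false_or, decide_eq_true (show code w σ ≥ 2 ^ w j by omega), Bool.true_and]
    have hkey : (∀ ρ, PrunedIn m A j ρ → σ ≠ ρ ∧ σ ≠ insert j ρ) ↔
        ¬ PrunedIn m A j (σ.erase j) := by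
      constructor
      · exact fun h hp => (h _ hp).2 (Finset.insert_erase hjσ).symm
      · rintro h ρ hρ
        constructor
        · rintro rfl
          exact hρ.1 hjσ
        · rintro rfl
          rw [Finset.erase_insert hρ.1] at h
          exact h hρ
    beta_reduce
    rw [hkey]
    have h3 : _ ↔ gr m σ = b ∧ σ ∈ A := hX σ hσ
    have h4 : _ ↔ gr m (σ.erase j) = b ∧ PrunedIn m A j (σ.erase j) := ht _ hσ'
    by_cases hp : gr m (σ.erase j) = b ∧ PrunedIn m A j (σ.erase j)
    · have h5 := hp.2.2.2
      rw [Finset.insert_erase hjσ] at h5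
      rw [h4.2 hp, h3.2 ⟨h5.2 ▸ hp.1, h5.1⟩]
      simp [hp.2]
    · rw [Bool.eq_false_iff.2 fun h => hp (h4.1 h), Bool.xor_false, h3]
      refine ⟨fun h => ⟨h.1, h.2, fun hp' => hp ⟨?_, hp'⟩⟩, fun h => ⟨h.1, h.2.1⟩⟩
      have := hp'.2.2.2
      rw [Finset.insert_erase hjσ] at this
      exact this.trans h.1
  -- A bit of the shifted mask sits at a position whose digit `w j` is `1`, since the lower ends
  -- lack that digit; the code of `σ` lacks it too.
  · have h1 : (decide (code w σ ≥ 2 ^ w j) &&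
        (Pruned.matched X (w j)).testBit (code w σ - 2 ^ w j)) = false := by
      rw [Bool.eq_false_iff, Ne, Bool.and_eq_true, decide_eq_true_iff]
      rintro ⟨hle, h⟩
      rw [matched_eq, Nat.testBit_and, Bool.and_eq_true] at h
      have h2 := testBit_of_testBit_lowMask (hw5 j hj) h.2
      have h3 := Nat.testBit_two_pow_add_eq (code w σ - 2 ^ w j) (w j)
      rw [Nat.add_sub_cancel' hle, h2] at h3
      exact hjσ ((testBit_code_apply hw hσ hj).1 h3)
    rw [h1, Bool.or_false]
    have hkey : (∀ ρ, PrunedIn m A j ρ → σ ≠ ρ ∧ σ ≠ insert j ρ) ↔ ¬ PrunedIn m A j σ := by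
      constructor
      · exact fun h hp => (h _ hp).1 rfl
      · rintro h ρ hρ
        constructor
        · rintro rfl
          exact h hρ
        · rintro rfl
          exact hjσ (Finset.mem_insert_self _ _)
    beta_reduce
    rw [hkey]
    have h3 : _ ↔ gr m σ = b ∧ σ ∈ A := hX σ hσ
    have h4 : _ ↔ gr m σ = b ∧ PrunedIn m A j σ := ht σ hσ
    by_cases hp : gr m σ = b ∧ PrunedIn m A j σ
    · rw [h4.2 hp, h3.2 ⟨hp.1, hp.2.2.1⟩]
      simp [hp.2]
    · rw [Bool.eq_false_iff.2 fun h => hp (h4.1 h), Bool.xor_false, h3]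
      exact ⟨fun h => ⟨h.1, h.2, fun hp' => hp ⟨h.1, hp'⟩⟩, fun h => ⟨h.1, h.2.1⟩⟩

theorem directions_of_mem {k : ℕ} (hk : k < q) (h : ⟨k, hk⟩ ∈ divisors m b) :
    directions m b w k = w ⟨k, hk⟩ :: directions m b w (k + 1) := by
  rw [directions, List.drop_eq_getElem_cons (by simpa using hk), List.getElem_finRange]
  simp [h, directions]

theorem directions_of_notMem {k : ℕ} (hk : k < q) (h : ⟨k, hk⟩ ∉ divisors m b) :
    directions m b w k = directions m b w (k + 1) := by
  rw [directions, List.drop_eq_getElem_cons (by simpa using hk), List.getElem_finRange]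
  simp [h, directions]

theorem PrunedIn.mem_divisors {A : Set (Finset (Fin q))} {j : Fin q} {σ : Finset (Fin q)}
    (h : PrunedIn m A j σ) (hb : gr m σ = b) : j ∈ divisors m b := by
  rw [Pruned.mem_divisors, ← hb, h.2.2.2]
  exact Finset.le_sup (f := m) (Finset.mem_insert_self j σ)

theorem Encodes.succ_of_mem (hw : Set.InjOn w (divisors m b))
    (hw5 : ∀ i ∈ divisors m b, w i < 5) {X k : ℕ} (hk : k < q)
    (hX : Encodes m b w X fun σ => gr m σ = b ∧ σ ∈ survivors m k)
    (h : ⟨k, hk⟩ ∈ divisors m b) :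
    Encodes m b w (Pruned.pruneStep X (w ⟨k, hk⟩) (Pruned.matched X (w ⟨k, hk⟩)))
      fun σ => gr m σ = b ∧ σ ∈ survivors m (k + 1) := by
  intro σ hσ
  rw [hX.pruneStep hw hw5 h σ hσ]
  refine and_congr_right fun _ => and_congr_right fun _ => ?_
  constructor
  · rintro h1 j rfl
    exact h1
  · exact fun h1 => h1 ⟨k, hk⟩ rfl

/-- An edge pruned inside the fiber over `b` inserts a generator dividing `b`. So the fiber sees
only the order induced on its divisors. -/
theorem Encodes.succ_of_notMem {X k : ℕ} (hk : k < q)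
    (hX : Encodes m b w X fun σ => gr m σ = b ∧ σ ∈ survivors m k)
    (h : ⟨k, hk⟩ ∉ divisors m b) :
    Encodes m b w X fun σ => gr m σ = b ∧ σ ∈ survivors m (k + 1) := by
  intro σ hσ
  rw [hX σ hσ]
  refine and_congr_right fun hb => ⟨fun h1 => ⟨h1, ?_⟩, fun h1 => h1.1⟩
  rintro j rfl ρ hρ
  constructor
  · rintro rfl
    exact h (hρ.mem_divisors hb)
  · rintro rfl
    exact h (hρ.mem_divisors (hρ.2.2.2.trans hb))

theorem Encodes.remaining (hw : Set.InjOn w (divisors m b))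
    (hw5 : ∀ i ∈ divisors m b, w i < 5) {X k : ℕ} (hk : k ≤ q)
    (hX : Encodes m b w X fun σ => gr m σ = b ∧ σ ∈ survivors m k) :
    Encodes m b w (Pruned.remaining (directions m b w k) X)
      fun σ => gr m σ = b ∧ σ ∈ survivors m q := by
  induction hk using Nat.decreasingInduction generalizing X with
  | self =>
    have : directions m b w q = [] := by
      rw [directions, List.drop_eq_nil_of_le (by simp)]
      rfl
    rw [this]
    exact hX
  | of_succ k hk ih =>
    by_cases h : ⟨k, hk⟩ ∈ divisors m b
    · rw [directions_of_mem hk h, remaining_cons]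
      exact ih (hX.succ_of_mem hw hw5 hk h)
    · rw [directions_of_notMem hk h]
      exact ih (hX.succ_of_notMem hk h)

theorem Encodes.testBit_flowUp (hw : Set.InjOn w (divisors m b))
    (hw5 : ∀ i ∈ divisors m b, w i < 5) {X k S : ℕ} (hk : k ≤ q)
    (hX : Encodes m b w X fun σ => gr m σ = b ∧ σ ∈ survivors m k) {j : Fin q} (hkj : k ≤ j)
    {σ : Finset (Fin q)} (hσ : PrunedIn m (survivors m j) j σ) (hb : gr m σ = b)
    (hS : S.testBit (code w σ) = true) :
    (flowUp S (directions m b w k) X).testBit (code w (insert j σ)) = true := by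
  induction hk using Nat.decreasingInduction generalizing X with
  | self => exact absurd j.2 (not_lt.2 hkj)
  | of_succ k hk ih =>
    by_cases h : ⟨k, hk⟩ ∈ divisors m b
    · rw [directions_of_mem hk h, flowUp_cons, Nat.testBit_or, Bool.or_eq_true]
      rcases hkj.eq_or_lt with rfl | hlt
      · left
        have hσd : σ ⊆ divisors m b := subset_divisors_iff.2 hb.le
        rw [code_insert hw hσd h hσ.1, Nat.testBit_shiftLeft, Nat.add_sub_cancel_left,
          Nat.testBit_and, hS, (hX.matched hw hw5 h σ hσd).2 ⟨hb, hσ⟩]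
        simp
      · right
        exact ih (hX.succ_of_mem hw hw5 hk h) hlt
    · rw [directions_of_notMem hk h]
      refine ih (hX.succ_of_notMem hk h) (hkj.lt_of_ne ?_)
      rintro rfl
      exact h (hσ.mem_divisors hb)

theorem testBit_facets (hw : Set.InjOn w (divisors m b)) (hw5 : ∀ i ∈ divisors m b, w i < 5)
    {T : ℕ} {L : List ℕ} {μ : Finset (Fin q)} (hμ : μ ⊆ divisors m b) {i : Fin q} (hi : i ∈ μ)
    (hL : w i ∈ L) (hT : T.testBit (code w μ) = true) :
    (facets T L).testBit (code w (μ.erase i)) = true := by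
  induction L with
  | nil => exact absurd hL List.not_mem_nil
  | cons k L ih =>
    rw [facets_cons, Nat.testBit_or, Bool.or_eq_true]
    rcases List.mem_cons.1 hL with rfl | hL
    · left
      have hd : μ.erase i ⊆ divisors m b := (Finset.erase_subset _ _).trans hμ
      rw [Nat.testBit_and, Nat.testBit_shiftRight,
        ← code_insert hw hd (hμ hi) (Finset.notMem_erase _ _), Finset.insert_erase hi, hT,
        (testBit_lowMask_code hw hw5 hd (hμ hi)).2 (Finset.notMem_erase _ _), Bool.true_and]
    · exact Or.inr (ih hL)

/-- Soundness of the check by masks. -/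
theorem morseMatrix_eq_zero_of_isGood {K : Type*} [Field K] (hw : Set.InjOn w (divisors m b))
    (hw5 : ∀ i ∈ divisors m b, w i < 5) {X : ℕ} (hX : Encodes m b w X fun σ => gr m σ = b)
    (hg : isGood (directions m b w 0) X = true) {σ τ : Finset (Fin q)} (hσ : gr m σ = b)
    (hτ : gr m τ = b) : morseMatrix K m σ τ = 0 := by
  obtain ⟨S, hS, hSC⟩ := exists_closed_of_isGood hg
  have hX0 : Encodes m b w X fun σ => gr m σ = b ∧ σ ∈ survivors m 0 := fun σ hσ =>
    (hX σ hσ).trans (and_iff_left trivial).symm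
  have hC := hX0.remaining hw hw5 (Nat.zero_le q)
  have hsub : ∀ {σ}, gr m σ = b → σ ⊆ divisors m b := fun h => subset_divisors_iff.2 h.le
  have hmem : ∀ {i}, i ∈ divisors m b → w i ∈ directions m b w 0 := fun hi =>
    List.mem_map_of_mem (by simpa using hi)
  have hstep : ∀ {μ ρ}, gr m μ = b → gr m ρ = b → IsEdge μ ρ →
      (Pruned.remaining (directions m b w 0) X ||| flowUp S (directions m b w 0) X).testBit
        (code w μ) = true → S.testBit (code w ρ) = true := by
    intro μ ρ hμ hρ he hT
    obtain ⟨i, hi, rfl⟩ := isEdge_iff.1 he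
    have h1 : (reachStep (directions m b w 0) X (Pruned.remaining (directions m b w 0) X) S).testBit
        (code w (μ.erase i)) = true := by
      rw [reachStep_eq, Nat.testBit_and, (hX _ (hsub hρ)).2 hρ, Bool.and_true]
      exact testBit_facets hw hw5 (hsub hμ) hi (hmem (hsub hμ hi)) hT
    rw [← hS, Nat.testBit_and, Bool.and_eq_true] at h1
    exact h1.2
  -- `reachStep` also follows a pruned edge back down, but this leads only to a cell already in `S`,
  -- so closedness is not affected.
  refine morseMatrix_eq_zero_of_closed {ρ | S.testBit (code w ρ) = true} ?_ ?_ ?_ hσ hτ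
  · intro σ ρ hσc hσ he hρ
    refine hstep hσ hρ he ?_
    rw [Nat.testBit_or, (hC σ (hsub hσ)).2 ⟨hσ, isCritical_iff_mem_survivors.1 hσc⟩, Bool.true_or]
  · rintro ρ ρ' hρS hρ ⟨_, ⟨j, rfl, hj⟩, he, -⟩ hρ'
    refine hstep (hj.2.2.2.symm.trans hρ) hρ' he ?_
    rw [Nat.testBit_or, hX0.testBit_flowUp hw hw5 (Nat.zero_le q) (Nat.zero_le _) hj hρ hρS,
      Bool.or_true]
  · intro τ hτS hτ hτc
    have h1 : (S &&& Pruned.remaining (directions m b w 0) X).testBit (code w τ) = true := by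
      rw [Nat.testBit_and, (hC τ (hsub hτ)).2 ⟨hτ, isCritical_iff_mem_survivors.1 hτc⟩,
        Bool.and_true]
      exact hτS
    rw [hSC, Nat.zero_testBit] at h1
    exact Bool.false_ne_true h1

end Encoding

/-! ### Enumeration of upper sets. -/

section Enumeration

/-- The number `X` encodes an upper set of subsets of `{0, …, N - 1}`. -/
def IsUpsetMask (N X : ℕ) : Prop :=
  X < 2 ^ 2 ^ N ∧ ∀ c i, i < N → 2 ^ i + c < 2 ^ N → c.testBit i = false → X.testBit c = true →
    X.testBit (2 ^ i + c) = true

theorem IsUpsetMask.mod {k X : ℕ} (h : IsUpsetMask (k + 1) X) :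
    IsUpsetMask k (X % 2 ^ 2 ^ k) := by
  refine ⟨Nat.mod_lt _ (Nat.two_pow_pos _), fun c i hi hc hb hX => ?_⟩
  rw [Nat.testBit_mod_two_pow, Bool.and_eq_true, decide_eq_true_iff] at hX ⊢
  have := pow_succ 2 k
  exact ⟨hc, h.2 c i (by omega) (by omega) hb hX.2⟩

theorem IsUpsetMask.shiftRight {k X : ℕ} (h : IsUpsetMask (k + 1) X) :
    IsUpsetMask k (X >>> 2 ^ k) := by
  constructor
  · rw [Nat.shiftRight_eq_div_pow, Nat.div_lt_iff_lt_mul (Nat.two_pow_pos _), ← pow_add, ← two_mul,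
      ← pow_succ']
    exact h.1
  · intro c i hi hc hb hX
    rw [Nat.testBit_shiftRight] at hX ⊢
    have := pow_succ 2 k
    have := h.2 (2 ^ k + c) i (by omega) (by omega)
      (by rw [Nat.testBit_two_pow_add_gt hi]; exact hb) hX
    rwa [add_left_comm] at this

theorem IsUpsetMask.testBit_shiftRight {k X c : ℕ} (h : IsUpsetMask (k + 1) X)
    (hc : (X % 2 ^ 2 ^ k).testBit c = true) : (X >>> 2 ^ k).testBit c = true := by
  rw [Nat.testBit_mod_two_pow, Bool.and_eq_true, decide_eq_true_iff] at hc
  rw [Nat.testBit_shiftRight]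
  have := pow_succ 2 k
  exact h.2 c k (by omega) (by omega) (Nat.testBit_lt_two_pow hc.1) hc.2

theorem forallUpset_succ (k l : ℕ) (f : ℕ → Bool) : forallUpset (k + 1) l f =
    forallUpset k (l % 2 ^ 2 ^ k) fun a => forallUpset k (l >>> 2 ^ k ||| a) fun b =>
      f (a ||| b <<< 2 ^ k) := by
  change force (Nat.mod l (Nat.pow 2 (Nat.pow 2 k))) (fun l₀ =>
    force (Nat.shiftRight l (Nat.pow 2 k)) fun l₁ => forallUpset k l₀ fun a =>
      force (Nat.lor l₁ a) fun l₂ => forallUpset k l₂ fun b =>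
        force (Nat.lor a (Nat.shiftLeft b (Nat.pow 2 k))) f) = _
  simp only [force_eq]
  rfl

/-- The sets without and with the last element form the low and the high half of `X`. Both halves
are upper sets, and the high one contains the low one, which is why the recursion passes a lower
bound. -/
theorem eq_true_of_forallUpset {k l : ℕ} {f : ℕ → Bool} (h : forallUpset k l f = true) {X : ℕ}
    (hX : IsUpsetMask k X) (hl : ∀ c, l.testBit c = true → X.testBit c = true) : f X = true := by
  induction k generalizing l f X with
  | zero =>
    change ((!(Nat.beq l 0) || f 0) && f 1) = true at h
    rw [Bool.and_eq_true] at h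
    have h2 : X < 2 := hX.1
    interval_cases X
    · have h0 : l = 0 := Nat.eq_of_testBit_eq fun i => by
        rw [Nat.zero_testBit, Bool.eq_false_iff]
        exact fun hi => Bool.false_ne_true ((Nat.zero_testBit i).symm.trans (hl i hi))
      subst h0
      exact h.1
    · exact h.2
  | succ k ih =>
    rw [forallUpset_succ] at h
    have h1 := ih h hX.mod fun c hc => by
      rw [Nat.testBit_mod_two_pow, Bool.and_eq_true] at hc ⊢
      exact ⟨hc.1, hl c hc.2⟩
    have h2 := ih h1 hX.shiftRight fun c hc => by
      rw [Nat.testBit_or, Bool.or_eq_true] at hc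
      rcases hc with hc | hc
      · rw [Nat.testBit_shiftRight] at hc ⊢
        exact hl _ hc
      · exact hX.testBit_shiftRight hc
    have h3 : X % 2 ^ 2 ^ k ||| (X >>> 2 ^ k) <<< 2 ^ k = X := Nat.eq_of_testBit_eq fun i => by
      rw [Nat.testBit_or, Nat.testBit_mod_two_pow, Nat.testBit_shiftLeft, Nat.testBit_shiftRight]
      rcases lt_or_ge i (2 ^ k) with hi | hi
      · simp [hi, not_le.2 hi]
      · simp [hi, not_lt.2 hi]
    rwa [h3] at h2

theorem eq_true_of_forallUpset_zero {k : ℕ} {f : ℕ → Bool} (h : forallUpset k 0 f = true) {X : ℕ}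
    (hX : IsUpsetMask k X) : f X = true :=
  eq_true_of_forallUpset h hX fun c hc => by simp at hc

end Enumeration

/-! ### Masks of fibers, and fibers with at most four divisors. -/

section FiberMask

variable {q n : ℕ} {m : Fin q → (Fin n →₀ ℕ)} {b : Fin n →₀ ℕ} {w : Fin q → ℕ}

theorem code_injOn (hw : Set.InjOn w (divisors m b)) {σ τ : Finset (Fin q)}
    (hσ : σ ⊆ divisors m b) (hτ : τ ⊆ divisors m b) (h : code w σ = code w τ) : σ = τ := by
  ext j
  by_cases hj : j ∈ divisors m b
  · rw [← testBit_code_apply hw hσ hj, h, testBit_code_apply hw hτ hj]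
  · exact iff_of_false (fun h => hj (hσ h)) fun h => hj (hτ h)

-- Adding a divisor of `b` to a cell of degree `b` keeps the degree, so the fiber is an upper set.
-- The last clause excludes bits that belong to no cell; the cone case uses it.
open Classical in
theorem exists_mask (hw : Set.InjOn w (divisors m b)) {N : ℕ}
    (hN : (divisors m b).image w = Finset.range N) :
    ∃ X, Encodes m b w X (fun σ => gr m σ = b) ∧ IsUpsetMask N X ∧
      ∀ c, X.testBit c = true → ∃ σ ⊆ divisors m b, code w σ = c ∧ gr m σ = b := by
  have hlt : ∀ i ∈ divisors m b, w i < N := fun i hi =>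
    Finset.mem_range.1 (hN ▸ Finset.mem_image_of_mem w hi)
  set s := (Finset.range (2 ^ N)).filter fun c => ∃ σ ⊆ divisors m b, code w σ = c ∧ gr m σ = b
    with hs
  have hbit : ∀ c, (∑ c ∈ s, 2 ^ c).testBit c = true ↔
      ∃ σ ⊆ divisors m b, code w σ = c ∧ gr m σ = b := by
    intro c
    rw [← Nat.mem_bitIndices, ← List.mem_toFinset, Finset.toFinset_bitIndices_sum_two_pow, hs,
      Finset.mem_filter, Finset.mem_range, and_iff_right_iff_imp]
    rintro ⟨σ, hσ, rfl, -⟩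
    exact code_lt hlt hσ
  refine ⟨∑ c ∈ s, 2 ^ c, fun σ hσ => ?_, ⟨?_, ?_⟩, fun c hc => (hbit c).1 hc⟩
  · rw [hbit]
    constructor
    · rintro ⟨τ, hτ, h, hb⟩
      rwa [← code_injOn hw hτ hσ h]
    · exact fun h => ⟨σ, hσ, rfl, h⟩
  · refine Nat.lt_pow_two_of_testBit _ fun c hc => ?_
    rw [Bool.eq_false_iff, Ne, hbit]
    rintro ⟨σ, hσ, rfl, -⟩
    exact absurd (code_lt hlt hσ) (not_lt.2 hc)
  · intro c i hi hc hci h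
    obtain ⟨σ, hσ, rfl, hb⟩ := (hbit c).1 h
    obtain ⟨j, hj, rfl⟩ := Finset.mem_image.1 (hN ▸ Finset.mem_range.2 hi)
    have hjσ : j ∉ σ := fun h' =>
      Bool.false_ne_true (hci.symm.trans ((testBit_code_apply hw hσ hj).2 h'))
    have hins := Finset.insert_subset hj hσ
    refine (hbit _).2 ⟨insert j σ, hins, code_insert hw hσ hj hjσ, ?_⟩
    exact le_antisymm (subset_divisors_iff.1 hins)
      (hb ▸ Finset.sup_mono (Finset.subset_insert j σ))

/-- The generators that divide `b` can be numbered in the order of the pruning algorithm. -/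
theorem exists_numbering (m : Fin q → (Fin n →₀ ℕ)) (b : Fin n →₀ ℕ) :
    ∃ w : Fin q → ℕ, Set.InjOn w (divisors m b) ∧
      (divisors m b).image w = Finset.range (divisors m b).card ∧
      directions m b w 0 = List.range (divisors m b).card := by
  set l := (List.finRange q).filter (· ∈ divisors m b) with hl
  have hmem : ∀ {i}, i ∈ l ↔ i ∈ divisors m b := by simp [hl]
  have hnd : l.Nodup := (List.nodup_finRange q).filter _
  have hcard : (divisors m b).card = l.length := by
    rw [← List.toFinset_card_of_nodup hnd]
    congr 1
    ext i
    rw [List.mem_toFinset, hmem]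
  have hdir : l.map (fun i => l.idxOf i) = List.range l.length := by
    refine List.ext_getElem (by simp) fun i h1 h2 => ?_
    rw [List.getElem_map, List.getElem_range, hnd.idxOf_getElem]
  refine ⟨fun i => l.idxOf i, ?_, ?_, ?_⟩
  · intro i hi j _ h
    exact (List.idxOf_inj (hmem.2 hi)).1 h
  · ext i
    rw [hcard, Finset.mem_range, ← List.mem_range, ← hdir, List.mem_map, Finset.mem_image]
    simp only [hmem]
  · rw [hcard, ← hdir]
    rfl

variable {K : Type*} [Field K]

theorem morseMatrix_eq_zero_of_card_le_three (h : (divisors m b).card ≤ 3) {σ τ : Finset (Fin q)}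
    (hσ : gr m σ = b) (hτ : gr m τ = b) : morseMatrix K m σ τ = 0 := by
  obtain ⟨w, hw, himg, hdir⟩ := exists_numbering m b
  obtain ⟨X, hX, hup, -⟩ := exists_mask hw himg
  have hlt : ∀ i ∈ divisors m b, w i < 5 := fun i hi => by
    have := Finset.mem_range.1 (himg ▸ Finset.mem_image_of_mem w hi)
    omega
  refine morseMatrix_eq_zero_of_isGood hw hlt hX ?_ hσ hτ
  rw [hdir]
  exact eq_true_of_forallUpset_zero
    (List.all_eq_true.1 isGood_range_of_le_three _ (List.mem_range.2 (by omega))) hup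

theorem morseMatrix_eq_zero_of_card_eq_four (h : (divisors m b).card = 4)
    (hface : ∃ a ∈ divisors m b, gr m ((divisors m b).erase a) ≠ b) {σ τ : Finset (Fin q)}
    (hσ : gr m σ = b) (hτ : gr m τ = b) : morseMatrix K m σ τ = 0 := by
  obtain ⟨w, hw, himg, hdir⟩ := exists_numbering m b
  rw [h] at himg hdir
  obtain ⟨X, hX, hup, -⟩ := exists_mask hw himg
  have hlt : ∀ i ∈ divisors m b, w i < 4 := fun i hi =>
    Finset.mem_range.1 (himg ▸ Finset.mem_image_of_mem w hi)
  refine morseMatrix_eq_zero_of_isGood hw (fun i hi => (hlt i hi).trans (by norm_num)) hX ?_ hσ hτ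
  rw [hdir]
  have hX4 := eq_true_of_forallUpset_zero isGood_range_four hup
  rw [Bool.or_eq_true] at hX4
  refine hX4.resolve_left fun hall => ?_
  obtain ⟨a, ha, hne⟩ := hface
  have hsub := Finset.erase_subset a (divisors m b)
  -- `15` codes all four divisors, so the triple omitting `a` has code `15 - 2 ^ w a`, one of the
  -- digits of `26752`.
  have hcode : 15 = 2 ^ w a + code w ((divisors m b).erase a) := by
    rw [← code_insert hw hsub ha (Finset.notMem_erase _ _), Finset.insert_erase ha, code, himg]
    rfl
  refine hne ((hX _ hsub).1 ?_)
  have hall' : X &&& 26752 = 26752 := Nat.eq_of_beq_eq_true hall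
  have hbit : (26752 : ℕ).testBit (code w ((divisors m b).erase a)) = true := by
    have hwa := hlt a ha
    generalize w a = k at hwa hcode
    generalize code w ((divisors m b).erase a) = c at hcode
    interval_cases k
    · obtain rfl : c = 14 := by omega
      decide
    · obtain rfl : c = 13 := by omega
      decide
    · obtain rfl : c = 11 := by omega
      decide
    · obtain rfl : c = 7 := by omega
      decide
  rw [← hall', Nat.testBit_and, Bool.and_eq_true] at hbit
  exact hbit.1

end FiberMask

/-! ### Choice of an order that is good in all fibers at once. -/

section Orders

variable {q n : ℕ} {g : Fin q → (Fin n →₀ ℕ)} {b : Fin n →₀ ℕ} {o : Fin q → Fin q}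

theorem gr_comp (g : Fin q → (Fin n →₀ ℕ)) (o : Fin q → Fin q) (σ : Finset (Fin q)) :
    gr (g ∘ o) σ = gr g (σ.image o) := by
  rw [gr, gr, Finset.sup_image]

/-- Labelling the `j`-th generator of the new order by `o j` keeps the mask fixed, so different
orders differ only in their list of directions. -/
theorem Encodes.comp {X : ℕ}
    (hX : Encodes g b Fin.val X fun σ => gr g σ = b) :
    Encodes (g ∘ o) b (fun j => (o j).val) X fun σ => gr (g ∘ o) σ = b := by
  intro σ hσ
  have h1 : code (fun j => (o j).val) σ = code Fin.val (σ.image o) := by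
    rw [code, code, Finset.image_image]
    rfl
  beta_reduce
  rw [h1, gr_comp]
  refine hX _ ?_
  rw [subset_divisors_iff] at hσ ⊢
  rwa [gr_comp] at hσ

variable {K : Type*} [Field K]

theorem morseMatrix_comp_eq_zero (hq : q ≤ 5) (ho : Function.Injective o) {X : ℕ}
    (hX : Encodes g b Fin.val X fun σ => gr g σ = b)
    (hg : isGood (directions (g ∘ o) b (fun j => (o j).val) 0) X = true)
    {σ τ : Finset (Fin q)} (hσ : gr (g ∘ o) σ = b) (hτ : gr (g ∘ o) τ = b) :
    morseMatrix K (g ∘ o) σ τ = 0 :=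
  morseMatrix_eq_zero_of_isGood ((Fin.val_injective.comp ho).injOn)
    (fun i _ => (o i).2.trans_le hq) hX.comp hg hσ hτ

theorem directions_eq {m : Fin q → (Fin n →₀ ℕ)} {w : Fin q → ℕ} {s : Finset (Fin q)}
    (h : divisors m b = s) : directions m b w 0 = ((List.finRange q).filter (· ∈ s)).map w := by
  rw [directions, h, List.drop_zero]

variable (K) in
/-- The differentials of the pruned complex have no invertible entries. -/
def HasNoUnits (m : Fin q → (Fin n →₀ ℕ)) : Prop :=
  ∀ σ τ, gr m σ = gr m τ → morseMatrix K m σ τ = 0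

theorem gr_divisors {m : Fin q → (Fin n →₀ ℕ)} (σ : Finset (Fin q)) :
    gr m (divisors m (gr m σ)) = gr m σ :=
  le_antisymm (subset_divisors_iff.1 subset_rfl)
    (Finset.sup_mono (subset_divisors_iff.2 le_rfl))

theorem exists_mask_val (h : divisors g b = Finset.univ) :
    ∃ X, Encodes g b Fin.val X (fun σ => gr g σ = b) ∧ IsUpsetMask q X ∧
      ∀ c, X.testBit c = true → ∃ σ ⊆ divisors g b, code Fin.val σ = c ∧ gr g σ = b := by
  refine exists_mask Fin.val_injective.injOn ?_
  ext i
  simp only [h, Finset.mem_image, Finset.mem_univ, true_and, Finset.mem_range]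
  exact ⟨fun ⟨j, hj⟩ => hj ▸ j.2, fun hi => ⟨⟨i, hi⟩, rfl⟩⟩

theorem divisors_gr_univ (g : Fin q → (Fin n →₀ ℕ)) :
    divisors g (gr g Finset.univ) = Finset.univ :=
  Finset.univ_subset_iff.1 (subset_divisors_iff.2 le_rfl)

theorem gr_comp_univ (ho : Function.Bijective o) :
    gr (g ∘ o) Finset.univ = gr g Finset.univ := by
  rw [gr_comp, Finset.image_univ_of_surjective ho.2]

/-- The fiber over the degree of the least common multiple of all generators. -/
theorem morseMatrix_comp_eq_zero_of_divisors_eq_univ (hq : q ≤ 5) (ho : Function.Bijective o)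
    {X : ℕ} (hX : Encodes g (gr g Finset.univ) Fin.val X fun σ => gr g σ = gr g Finset.univ)
    (hg : isGood ((List.finRange q).map fun j => (o j).val) X = true) {σ τ : Finset (Fin q)}
    (hστ : gr (g ∘ o) σ = gr (g ∘ o) τ)
    (hd : divisors (g ∘ o) (gr (g ∘ o) σ) = Finset.univ) : morseMatrix K (g ∘ o) σ τ = 0 := by
  have hb : gr (g ∘ o) σ = gr g Finset.univ := by
    rw [← gr_comp_univ ho, ← gr_divisors σ, hd]
  refine morseMatrix_comp_eq_zero hq ho.1 hX ?_ hb (hστ ▸ hb)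
  rw [directions_eq (hb ▸ hd)]
  simpa using hg

theorem exists_hasNoUnits_four (g : Fin 4 → (Fin n →₀ ℕ)) :
    ∃ o : Fin 4 → Fin 4, Function.Bijective o ∧ HasNoUnits K (g ∘ o) := by
  obtain ⟨X, hX, hup, -⟩ := exists_mask_val (divisors_gr_univ g)
  have key : ∀ o : Fin 4 → Fin 4, Function.Bijective o →
      isGood ((List.finRange 4).map fun j => (o j).val) X = true → HasNoUnits K (g ∘ o) := by
    intro o ho hg σ τ h
    rcases (Finset.card_le_univ (divisors (g ∘ o) (gr (g ∘ o) σ))).lt_or_eq with hc | hc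
    · exact morseMatrix_eq_zero_of_card_le_three (Nat.le_of_lt_succ hc) rfl h.symm
    · exact morseMatrix_comp_eq_zero_of_divisors_eq_univ (by norm_num) ho hX hg h
        ((Finset.card_eq_iff_eq_univ _).1 hc)
  have hm := eq_true_of_forallUpset_zero majority_isGood_four hup
  by_cases h1 : isGood [0, 1, 2, 3] X = true
  · exact ⟨![0, 1, 2, 3], by decide, key _ (by decide) h1⟩
  · refine ⟨![1, 2, 0, 3], by decide, key _ (by decide) ?_⟩
    rw [Bool.not_eq_true] at h1
    rw [h1, majority, Bool.false_and, Bool.false_and, Bool.false_or, Bool.false_or,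
      Bool.and_eq_true] at hm
    exact hm.1

/-- The generators except for the `c`-th one have another least common multiple than all generators
together, but every three of them have the same one. -/
def IsHollow (g : Fin 5 → (Fin n →₀ ℕ)) (c : Fin 5) : Prop :=
  gr g (Finset.univ.erase c) ≠ gr g Finset.univ ∧
    ∀ a ≠ c, gr g ((Finset.univ.erase c).erase a) = gr g (Finset.univ.erase c)

/-- If `c ≠ c'` were both hollow, the lcms omitting `c` and omitting `c'` would both equal the lcm
omitting both. Their join is the lcm of all generators, a contradiction. -/
theorem IsHollow.unique {g : Fin 5 → (Fin n →₀ ℕ)} {c c' : Fin 5} (h : IsHollow g c)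
    (h' : IsHollow g c') : c = c' := by
  by_contra hne
  have h1 := h.2 c' (Ne.symm hne)
  rw [Finset.erase_right_comm, h'.2 c hne] at h1
  have hu : Finset.univ.erase c ∪ Finset.univ.erase c' = (Finset.univ : Finset (Fin 5)) := by
    ext i
    by_cases hi : i = c
    · simp [hi, hne]
    · simp [hi]
  have hsup : gr g Finset.univ =
      gr g (Finset.univ.erase c) ⊔ gr g (Finset.univ.erase c') := by
    rw [gr, gr, gr, ← Finset.sup_union, hu]
  exact h.1 (by rw [hsup, h1, sup_idem])

theorem IsHollow.of_comp {g : Fin 5 → (Fin n →₀ ℕ)} {o : Fin 5 → Fin 5}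
    (ho : Function.Bijective o) {c : Fin 5} (h : IsHollow (g ∘ o) c) : IsHollow g (o c) := by
  have himg : (Finset.univ.erase c).image o = Finset.univ.erase (o c) := by
    rw [Finset.image_erase ho.1, Finset.image_univ_of_surjective ho.2]
  refine ⟨?_, fun a ha => ?_⟩
  · have := h.1
    rwa [gr_comp_univ ho, gr_comp, himg] at this
  · obtain ⟨a, rfl⟩ := ho.2 a
    have := h.2 a fun hac => ha (hac ▸ rfl)
    rwa [gr_comp, gr_comp, Finset.image_erase ho.1, himg] at this

/-- The fibers over which at most four generators live. -/
theorem isHollow_or_morseMatrix_eq_zero (m : Fin 5 → (Fin n →₀ ℕ)) {σ τ : Finset (Fin 5)}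
    (h : gr m σ = gr m τ) : divisors m (gr m σ) = Finset.univ ∨ morseMatrix K m σ τ = 0 ∨
      ∃ c, divisors m (gr m σ) = Finset.univ.erase c ∧ IsHollow m c := by
  by_cases h3 : (divisors m (gr m σ)).card ≤ 3
  · exact Or.inr (Or.inl (morseMatrix_eq_zero_of_card_le_three h3 rfl h.symm))
  · rcases (Finset.card_le_univ (divisors m (gr m σ))).lt_or_eq with hc | hc
    · right
      rw [Fintype.card_fin] at hc
      by_cases hface : ∃ a ∈ divisors m (gr m σ), gr m ((divisors m (gr m σ)).erase a) ≠ gr m σ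
      · exact Or.inl (morseMatrix_eq_zero_of_card_eq_four (by omega) hface rfl h.symm)
      · right
        push Not at hface
        obtain ⟨c, hc'⟩ := Finset.card_eq_one.1
          (show (divisors m (gr m σ))ᶜ.card = 1 by rw [Finset.card_compl, Fintype.card_fin]; omega)
        have hd : divisors m (gr m σ) = Finset.univ.erase c := by
          rw [← compl_compl (divisors m (gr m σ)), hc', Finset.compl_singleton]
        refine ⟨c, hd, ?_, fun a ha => ?_⟩
        · rw [← hd, gr_divisors]
          intro hu
          rw [hu, divisors_gr_univ] at hd
          exact Finset.notMem_erase c Finset.univ (hd ▸ Finset.mem_univ c)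
        · rw [← hd, gr_divisors]
          exact hface a (hd ▸ Finset.mem_erase.2 ⟨ha, Finset.mem_univ a⟩)
    · exact Or.inl ((Finset.card_eq_iff_eq_univ _).1 hc)

theorem exists_hasNoUnits_of_not_isHollow (g : Fin 5 → (Fin n →₀ ℕ)) (hg : ∀ c, ¬ IsHollow g c) :
    ∃ o : Fin 5 → Fin 5, Function.Bijective o ∧ HasNoUnits K (g ∘ o) := by
  obtain ⟨X, hX, hup, -⟩ := exists_mask_val (divisors_gr_univ g)
  have key : ∀ o : Fin 5 → Fin 5, Function.Bijective o →
      isGood ((List.finRange 5).map fun j => (o j).val) X = true → HasNoUnits K (g ∘ o) := by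
    intro o ho h σ τ hστ
    rcases isHollow_or_morseMatrix_eq_zero (K := K) (g ∘ o) hστ with hd | h0 | ⟨c, -, hc⟩
    · exact morseMatrix_comp_eq_zero_of_divisors_eq_univ le_rfl ho hX h hστ hd
    · exact h0
    · exact absurd (hc.of_comp ho) (hg _)
  have h5 := eq_true_of_forallUpset_zero isGood_five hup
  rw [Bool.or_eq_true, Bool.or_eq_true] at h5
  rcases h5 with (h | h) | h
  · exact ⟨![0, 1, 2, 3, 4], by decide, key _ (by decide) h⟩
  · exact ⟨![1, 2, 0, 3, 4], by decide, key _ (by decide) h⟩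
  · exact ⟨![3, 4, 0, 1, 2], by decide, key _ (by decide) h⟩

theorem exists_common_of_majority {a b c a' b' c' : Bool} (h : majority a b c = true)
    (h' : majority a' b' c' = true) :
    (a = true ∧ a' = true) ∨ (b = true ∧ b' = true) ∨ (c = true ∧ c' = true) := by
  revert a b c a' b' c'
  decide

/-- Only the full fiber, with mask `X`, and the hollow one, with mask `Y`, constrain the order. Each
accepts two of the same three orders, so the pigeonhole principle gives a common one. -/
theorem exists_hasNoUnits_of_isHollow_last (g : Fin 5 → (Fin n →₀ ℕ)) (hg : IsHollow g 4) :
    ∃ o : Fin 5 → Fin 5, Function.Bijective o ∧ HasNoUnits K (g ∘ o) := by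
  set b := gr g (Finset.univ.erase 4) with hb
  have hdb : divisors g b = Finset.univ.erase 4 := by
    refine Finset.Subset.antisymm (fun i hi => Finset.mem_erase.2 ⟨?_, Finset.mem_univ i⟩)
      (subset_divisors_iff.2 le_rfl)
    rintro rfl
    refine hg.1 (le_antisymm (Finset.sup_mono (Finset.erase_subset _ _)) ?_)
    rw [← Finset.insert_erase (Finset.mem_univ (4 : Fin 5)), gr, Finset.sup_insert]
    exact sup_le (mem_divisors.1 hi) le_rfl
  obtain ⟨Y, hY, hYup, -⟩ := exists_mask (m := g) (b := b) (w := Fin.val) (N := 4)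
    Fin.val_injective.injOn (by rw [hdb]; decide)
  obtain ⟨X, hX, hXup, hXc⟩ := exists_mask_val (divisors_gr_univ g)
  -- Bits below `16` belong to cells without the vertex `4`. Their lcm divides that of the first
  -- four generators and so is not the full one; hence `X` is a cone.
  have hX16 : (X >>> 16) <<< 16 = X := Nat.eq_of_testBit_eq fun i => by
    rw [Nat.testBit_shiftLeft, Nat.testBit_shiftRight]
    rcases lt_or_ge i 16 with hi | hi
    · rw [decide_eq_false (not_le.2 hi), Bool.false_and, eq_comm, Bool.eq_false_iff]
      intro hbit
      obtain ⟨σ, -, rfl, hσ⟩ := hXc i hbit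
      have h4 : (4 : Fin 5) ∉ σ := by
        intro h4
        have h1 := (testBit_code (w := Fin.val) σ 4).2 (Finset.mem_image.2 ⟨4, h4, rfl⟩)
        rw [Nat.testBit_lt_two_pow hi] at h1
        exact Bool.false_ne_true h1
      refine hg.1 (le_antisymm (Finset.sup_mono (Finset.erase_subset _ _)) ?_)
      rw [← hσ]
      exact Finset.sup_mono fun i hi =>
        Finset.mem_erase.2 ⟨fun h => h4 (h ▸ hi), Finset.mem_univ i⟩
    · rw [decide_eq_true hi, Bool.true_and, Nat.add_sub_cancel' hi]
  have hmX := eq_true_of_forallUpset_zero majority_isGood_cone hXup.shiftRight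
  have hmY := eq_true_of_forallUpset_zero majority_isGood_four hYup
  rw [force_eq] at hmX
  change majority (isGood _ ((X >>> 16) <<< 16)) (isGood _ ((X >>> 16) <<< 16))
    (isGood _ ((X >>> 16) <<< 16)) = true at hmX
  rw [hX16] at hmX
  have key : ∀ o : Fin 5 → Fin 5, Function.Bijective o → o 4 = 4 →
      isGood ((List.finRange 5).map fun j => (o j).val) X = true →
      isGood (((List.finRange 5).filter (· ∈ Finset.univ.erase 4)).map fun j => (o j).val) Y =
        true → HasNoUnits K (g ∘ o) := by
    intro o ho ho4 h h' σ τ hστ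
    rcases isHollow_or_morseMatrix_eq_zero (K := K) (g ∘ o) hστ with hd | h0 | ⟨c, hd, hc⟩
    · exact morseMatrix_comp_eq_zero_of_divisors_eq_univ le_rfl ho hX h hστ hd
    · exact h0
    · have hoc : o c = o 4 := ((hc.of_comp ho).unique hg).trans ho4.symm
      obtain rfl := ho.1 hoc
      have hσb : gr (g ∘ o) σ = b := by
        rw [← gr_divisors σ, hd, gr_comp, Finset.image_erase ho.1,
          Finset.image_univ_of_surjective ho.2, ho4]
      refine morseMatrix_comp_eq_zero le_rfl ho.1 hY ?_ hσb (hστ ▸ hσb)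
      rw [directions_eq (hσb ▸ hd)]
      exact h'
  rcases exists_common_of_majority hmX hmY with h | h | h
  · exact ⟨![0, 1, 2, 3, 4], by decide, key _ (by decide) (by decide) h.1 h.2⟩
  · exact ⟨![1, 2, 0, 3, 4], by decide, key _ (by decide) (by decide) h.1 h.2⟩
  · exact ⟨![2, 0, 1, 3, 4], by decide, key _ (by decide) (by decide) h.1 h.2⟩

theorem exists_hasNoUnits (hq : q ≤ 5) (g : Fin q → (Fin n →₀ ℕ)) :
    ∃ o : Fin q → Fin q, Function.Bijective o ∧ HasNoUnits K (g ∘ o) := by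
  rcases (show q ≤ 3 ∨ q = 4 ∨ q = 5 by omega) with h | rfl | rfl
  · refine ⟨id, Function.bijective_id, fun σ τ hστ => ?_⟩
    exact morseMatrix_eq_zero_of_card_le_three
      ((Finset.card_le_univ _).trans ((Fintype.card_fin q).trans_le h)) rfl hστ.symm
  · exact exists_hasNoUnits_four g
  · by_cases h : ∃ c, IsHollow g c
    · obtain ⟨c, hc⟩ := h
      have hs : Function.Bijective (Equiv.swap c 4) := (Equiv.swap c 4).bijective
      -- The swap moves the generator omitted by the hollow fiber to the last place.
      obtain ⟨o, ho, h⟩ := exists_hasNoUnits_of_isHollow_last (K := K) (g ∘ Equiv.swap c 4) (by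
        have hcomp : (g ∘ Equiv.swap c 4) ∘ Equiv.swap c 4 = g := by
          ext i
          simp
        rw [← hcomp] at hc
        simpa using hc.of_comp hs)
      exact ⟨Equiv.swap c 4 ∘ o, hs.comp ho, h⟩
    · push Not at h
      exact exists_hasNoUnits_of_not_isHollow g h

end Orders

end Pruned

theorem theorem3p4 {K : Type*} [Field K] {n : ℕ} (I : Ideal (MvPolynomial (Fin n) K))
    (hI : Pruned.IsSquarefreeMonomialIdeal I)
    (hq : (Pruned.minimalGenerators I).encard ≤ 5) :
    Pruned.AdmitsMinimalPrunedResolution I := by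
  have hfin : (Pruned.minimalGenerators I).Finite :=
    Set.finite_of_encard_le_coe (k := 5) (by exact_mod_cast hq)
  have hcard : hfin.toFinset.card ≤ 5 := by
    rw [hfin.encard_eq_coe_toFinset_card] at hq
    exact_mod_cast hq
  let e := hfin.toFinset.equivFin.symm
  obtain ⟨o, ho, h⟩ := Pruned.exists_hasNoUnits (K := K) hcard fun i => (e i : Fin n →₀ ℕ)
  have hrange : Set.range ((fun i => (e i : Fin n →₀ ℕ)) ∘ o) = Pruned.minimalGenerators I := by
    rw [ho.2.range_comp]
    ext a
    constructor
    · rintro ⟨i, rfl⟩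
      exact hfin.mem_toFinset.1 (e i).2
    · intro ha
      exact ⟨e.symm ⟨a, hfin.mem_toFinset.2 ha⟩, by simp⟩
  refine ⟨_, (fun i => (e i : Fin n →₀ ℕ)) ∘ o,
    (Subtype.val_injective.comp e.injective).comp ho.1, hrange,
    Pruned.isResolution (fun i => ?_) (fun x hx b hb => ?_),
    Pruned.isMinimal_of_morseMatrix_eq_zero h⟩
  · have hi := Set.mem_range_self (f := (fun i => (e i : Fin n →₀ ℕ)) ∘ o) i
    rw [hrange] at hi
    exact hi.1
  · obtain ⟨a, ha, hab⟩ := hI.exists_minimalGenerator_le hx hb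
    obtain ⟨i, rfl⟩ := hrange.symm ▸ ha
    exact ⟨i, hab⟩
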